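/- Let $Ap$ be a finite set of atomic propositions. LTL formulas are in negation normal form, $\varphi ::= \mathbf{tt} \mid \mathbf{ff} \mid a \mid \neg a \mid \varphi\wedge\varphi \mid \varphi\vee\varphi \mid \mathbf{X}\varphi \mid \mathbf{F}\varphi \mid \mathbf{G}\varphi \mid \varphi\mathbf{U}\varphi$, interpreted over words in $(2^{Ap})^\omega$; $\mathrm{sf}(\varphi)$ is the set of subformulas of $\varphi$ and $\mathbb{G}(\varphi)$ the set of those of the form $\mathbf{G}\psi$. For sets $T,F$ of formulas, $\psi[T,F]$ is $\psi$ with every maximal occurrence of a formula of $T$ replaced by $\mathbf{tt}$ and every maximal occurrence of a formula of $F$ replaced by $\mathbf{ff}$. For $\mathcal G\subseteq\mathbb{G}(\varphi)$ write $\psi[\mathcal G]=\psi[\mathcal G,\mathbb{G}(\varphi)\setminus\mathcal G]$. For a letter $\nu\subseteq Ap$ define $af(\mathbf{tt},\nu)=\mathbf{tt}$, $af(\mathbf{ff},\nu)=\mathbf{ff}$; $af(a,\nu)=\mathbf{tt}$ if $a\in\nu$ and $\mathbf{ff}$ otherwise; $af(\neg a,\nu)=\mathbf{ff}$ if $a\in\nu$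 and $\mathbf{tt}$ otherwise; $af$ commutes with $\wedge$ and $\vee$; $af(\mathbf{X}\psi,\nu)=\psi$; $af(\mathbf{F}\psi,\nu)=af(\psi,\nu)\vee\mathbf{F}\psi$; $af(\mathbf{G}\psi,\nu)=af(\psi,\nu)\wedge\mathbf{G}\psi$; $af(\psi\mathbf{U}\chi,\nu)=af(\chi,\nu)\vee(af(\psi,\nu)\wedge\psi\mathbf{U}\chi)$. Formulas are identified when they are propositionally equivalent (every maximal subformula that is not $\mathbf{tt}$, $\mathbf{ff}$, a conjunction or a disjunction being read as a propositional variable), and $Reach(\psi)$ is the set of all (classes of) formulas obtained from $\psi$ by applying $af(\cdot,\nu)$ finitely often. The automaton $\mathcal A_\varphi$ of Sickert et al. over the alphabet $2^{Ap}$, with $\varepsilon$-transitions and a generalized transition-based Büchi condition, is the following. - Initial component: the states are $Reach(\varphi)$, the initial state is $\varphi$, and the transitions are $\psi\xrightarrow{\nu}af(\psi,\nu)$. - Monitor for $\mathbf{G}\psi'$: the initial state is $(\psi',\mathbf{tt})$; from $(\xi_1,\xi_2)$ the letter $\nu$ leads to $(af(\xi_2,\nu)\wedge\psi',\mathbf{tt})$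 by an accepting transition if $af(\xi_1,\nu)=\mathbf{tt}$, and to $(af(\xi_1,\nu),af(\xi_2,\nu)\wedge\psi')$ by a non-accepting one otherwise; its states are the pairs reachable from the initial state. - Accepting component: the disjoint union of subcomponents $\mathcal A_{\mathcal G}$, one for each $\mathcal G=\{\mathbf{G}\psi_1,\dots,\mathbf{G}\psi_n\}\subseteq\mathbb{G}(\varphi)$. The states of $\mathcal A_{\mathcal G}$ are the tuples $(q,p_1,\dots,p_n)$ with $q\in Reach(\chi[\mathcal G])$ for some $\chi\in Reach(\varphi)$ and $p_i$ a state of the monitor for $\mathbf{G}(\psi_i[\mathcal G])$. A letter $\nu$ sends $q$ to $af(q,\nu)$ and acts on each $p_i$ as in its monitor. - There is an $\varepsilon$-transition from each state $\chi$ of the initial component to $(\chi[\mathcal G],(\psi_1[\mathcal G],\mathbf{tt}),\dots,(\psi_n[\mathcal G],\mathbf{tt}))$ in $\mathcal A_{\mathcal G}$, for each $\mathcal G\subseteq\mathbb{G}(\varphi)$. - A run is accepting iff it enters some $\mathcal A_{\mathcal G}$ and there takes infinitely often transitions leaving a state with $q=\mathbf{tt}$ and, for each $i$, infinitely often transitions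 that leave a state with $q=\mathbf{tt}$ and are accepting for the $i$-th monitor. **Proposition.** For every LTL formula $\varphi$ there is a map assigning to each state $s$ of $\mathcal A_\varphi$ an LTL formula $label(s)$ such that (i) the set $\mathsf L(s)$ of words accepted by $\mathcal A_\varphi$ from $s$ equals $\mathsf L(label(s))=\{w\mid w\models label(s)\}$; (ii) there are disjoint sets $T_s,F_s$ of formulas such that $label(s)$ is a Boolean combination (built with $\mathbf{tt},\mathbf{ff},\wedge,\vee$) of formulas $\psi[T_s,F_s]$ with $\psi\in\mathrm{sf}(\varphi)$. Moreover, with $Q_d$ the set of states of the accepting component, $\mathcal A_\varphi$ is an initial-deterministic LDBA: it has finitely many states; the initial state is not in $Q_d$; accepting transitions are transitions within $Q_d$; a state of $Q_d$ has at most one successor for each letter and no $\varepsilon$-transition; $Q_d$ is never left; and each state outside $Q_d$ has, for each letter, exactly one successor outside $Q_d$ and no $\varepsilon$-transition to a state outside $Q_d$. -/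

import Mathlib

/-- Formulas of linear temporal logic in negation normal form over the atomic propositions `Ap`. -/
inductive LTL (Ap : Type*) where
  | tt : LTL Ap
  | ff : LTL Ap
  | lit : Ap → LTL Ap
  | nlit : Ap → LTL Ap
  | conj : LTL Ap → LTL Ap → LTL Ap
  | disj : LTL Ap → LTL Ap → LTL Ap
  | next : LTL Ap → LTL Ap
  | ev : LTL Ap → LTL Ap
  | glob : LTL Ap → LTL Ap
  | untl : LTL Ap → LTL Ap → LTL Ap

namespace LTL

variable {Ap : Type*}

/-- `Sat φ w`: the infinite word `w` over the alphabet `2^Ap` satisfies `φ`. -/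
def Sat : LTL Ap → (ℕ → Set Ap) → Prop
  | tt, _ => True
  | ff, _ => False
  | lit a, w => a ∈ w 0
  | nlit a, w => a ∉ w 0
  | conj φ ψ, w => Sat φ w ∧ Sat ψ w
  | disj φ ψ, w => Sat φ w ∨ Sat ψ w
  | next φ, w => Sat φ (fun n => w (n + 1))
  | ev φ, w => ∃ k, Sat φ (fun n => w (n + k))
  | glob φ, w => ∀ k, Sat φ (fun n => w (n + k))
  | untl φ ψ, w => ∃ k, Sat ψ (fun n => w (n + k)) ∧ ∀ j < k, Sat φ (fun n => w (n + j))

/-- The language of a formula. -/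
def lang (φ : LTL Ap) : Set (ℕ → Set Ap) := {w | Sat φ w}

/-- The set of subformulas of a formula (including the formula itself). -/
def sf : LTL Ap → Set (LTL Ap)
  | tt => {tt}
  | ff => {ff}
  | lit a => {lit a}
  | nlit a => {nlit a}
  | conj φ ψ => insert (conj φ ψ) (sf φ ∪ sf ψ)
  | disj φ ψ => insert (disj φ ψ) (sf φ ∪ sf ψ)
  | next φ => insert (next φ) (sf φ)
  | ev φ => insert (ev φ) (sf φ)
  | glob φ => insert (glob φ) (sf φ)
  | untl φ ψ => insert (untl φ ψ) (sf φ ∪ sf ψ)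

/-- The set of `G`-subformulas of a formula. -/
def gsf (φ : LTL Ap) : Set (LTL Ap) := {χ | χ ∈ sf φ ∧ ∃ ψ, χ = glob ψ}

/-- One step of substitution: `tt` if the formula `φ` is in `T`, `ff` if it is in `F`,
and otherwise `φ'`. -/
noncomputable def replace (T F : Set (LTL Ap)) (φ φ' : LTL Ap) : LTL Ap :=
  open Classical in if φ ∈ T then tt else if φ ∈ F then ff else φ'

/-- `φ[T, F]`: every maximal occurrence in `φ` of a formula of `T` is replaced by `tt`,
and every maximal occurrence of a formula of `F` by `ff`. -/
noncomputable def subst (T F : Set (LTL Ap)) : LTL Ap → LTL Ap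
  | tt => replace T F tt tt
  | ff => replace T F ff ff
  | lit a => replace T F (lit a) (lit a)
  | nlit a => replace T F (nlit a) (nlit a)
  | conj φ ψ => replace T F (conj φ ψ) (conj (subst T F φ) (subst T F ψ))
  | disj φ ψ => replace T F (disj φ ψ) (disj (subst T F φ) (subst T F ψ))
  | next φ => replace T F (next φ) (next (subst T F φ))
  | ev φ => replace T F (ev φ) (ev (subst T F φ))
  | glob φ => replace T F (glob φ) (glob (subst T F φ))
  | untl φ ψ => replace T F (untl φ ψ) (untl (subst T F φ) (subst T F ψ))

/-- The set of Boolean combinations of formulas of `S`. Formulas in negation normal form have no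
negation connective, so these are built with `tt`, `ff`, conjunction and disjunction. -/
inductive IsBoolComb (S : Set (LTL Ap)) : LTL Ap → Prop
  | base (φ : LTL Ap) : φ ∈ S → IsBoolComb S φ
  | tt : IsBoolComb S tt
  | ff : IsBoolComb S ff
  | conj (φ ψ : LTL Ap) : IsBoolComb S φ → IsBoolComb S ψ → IsBoolComb S (conj φ ψ)
  | disj (φ ψ : LTL Ap) : IsBoolComb S φ → IsBoolComb S ψ → IsBoolComb S (disj φ ψ)

/-- The "after" function: `af φ ν` is what has to hold after reading the letter `ν` in order that
`φ` holds before it. -/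
noncomputable def af : LTL Ap → Set Ap → LTL Ap
  | tt, _ => tt
  | ff, _ => ff
  | lit a, ν => open Classical in if a ∈ ν then tt else ff
  | nlit a, ν => open Classical in if a ∈ ν then ff else tt
  | conj φ ψ, ν => conj (af φ ν) (af ψ ν)
  | disj φ ψ, ν => disj (af φ ν) (af ψ ν)
  | next φ, _ => φ
  | ev φ, ν => disj (af φ ν) (ev φ)
  | glob φ, ν => conj (af φ ν) (glob φ)
  | untl φ ψ, ν => disj (af ψ ν) (conj (af φ ν) (untl φ ψ))

/-- The truth value, under the valuation `v` of the variables `x_ψ`, of the propositional formula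
obtained from a formula by replacing each maximal subformula `ψ` that is neither a constant,
nor a conjunction, nor a disjunction by the propositional variable `x_ψ`. -/
def propEval (v : LTL Ap → Prop) : LTL Ap → Prop
  | tt => True
  | ff => False
  | conj φ ψ => propEval v φ ∧ propEval v ψ
  | disj φ ψ => propEval v φ ∨ propEval v ψ
  | ψ => v ψ

/-- Propositional equivalence of formulas. -/
def propSetoid (Ap : Type*) : Setoid (LTL Ap) where
  r φ ψ := ∀ v, propEval v φ ↔ propEval v ψ
  iseqv := ⟨fun _ _ => Iff.rfl, fun h v => (h v).symm, fun h h' v => (h v).trans (h' v)⟩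

theorem propEval_af (v : LTL Ap → Prop) (ν : Set Ap) (φ : LTL Ap) :
    propEval v (af φ ν) ↔ propEval (fun ψ => propEval v (af ψ ν)) φ := by
  induction φ <;> simp_all [af, propEval]

theorem propEval_subst (v : LTL Ap → Prop) {T F : Set (LTL Ap)}
    (hT : ∀ χ ∈ T, ∃ ψ, χ = glob ψ) (hF : ∀ χ ∈ F, ∃ ψ, χ = glob ψ) (φ : LTL Ap) :
    propEval v (subst T F φ) ↔ propEval (fun ψ => propEval v (subst T F ψ)) φ := by
  have key : ∀ χ χ' : LTL Ap, (∀ ψ, χ ≠ glob ψ) → replace T F χ χ' = χ' := by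
    intro χ χ' h
    have h1 : χ ∉ T := fun hm => (hT χ hm).elim h
    have h2 : χ ∉ F := fun hm => (hF χ hm).elim h
    simp [replace, h1, h2]
  induction φ with
  | tt => rw [subst, key _ _ (by simp)]; simp [propEval]
  | ff => rw [subst, key _ _ (by simp)]; simp [propEval]
  | conj φ ψ h1 h2 => rw [subst, key _ _ (by simp)]; simp [propEval, h1, h2]
  | disj φ ψ h1 h2 => rw [subst, key _ _ (by simp)]; simp [propEval, h1, h2]
  | _ => simp [propEval]

/-- Classes of formulas modulo propositional equivalence. -/
abbrev Cls (Ap : Type*) := Quotient (propSetoid Ap)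

namespace Cls

/-- The class of a formula. -/
def mk (φ : LTL Ap) : Cls Ap := Quotient.mk _ φ

/-- Conjunction on classes. -/
def conj : Cls Ap → Cls Ap → Cls Ap :=
  Quotient.map₂ LTL.conj fun _ _ h _ _ h' v => and_congr (h v) (h' v)

/-- The function `af` on classes. -/
noncomputable def af (c : Cls Ap) (ν : Set Ap) : Cls Ap :=
  Quotient.map (fun φ => LTL.af φ ν)
    (fun φ ψ h v => by rw [propEval_af, propEval_af]; exact h _) c

/-- The classes reachable from a class by reading finite words with `af`. -/
def reach (c : Cls Ap) : Set (Cls Ap) := {d | ∃ u : List (Set Ap), d = u.foldl af c}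

end Cls

/-- A set `𝒢` of `G`-subformulas of `φ`. -/
def GSet (φ : LTL Ap) : Type _ := {𝒢 : Set (LTL Ap) // 𝒢 ⊆ gsf φ}

/-- `ψ[𝒢]`, short for `ψ[𝒢, gsf φ \ 𝒢]`. -/
noncomputable def atG {φ : LTL Ap} (𝒢 : GSet φ) (ψ : LTL Ap) : LTL Ap :=
  subst 𝒢.1 (gsf φ \ 𝒢.1) ψ

/-- The operation `ψ ↦ ψ[𝒢]` on classes. -/
noncomputable def Cls.atG {φ : LTL Ap} (𝒢 : GSet φ) : Cls Ap → Cls Ap :=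
  Quotient.map (LTL.atG 𝒢) (fun ψ ψ' h v => by
    have hT : ∀ χ ∈ 𝒢.1, ∃ θ, χ = glob θ := fun χ hχ => (𝒢.2 hχ).2
    have hF : ∀ χ ∈ gsf φ \ 𝒢.1, ∃ θ, χ = glob θ := fun χ hχ => hχ.1.2
    unfold LTL.atG
    rw [propEval_subst v hT hF, propEval_subst v hT hF]; exact h _)

/-! ### The monitor for a formula `G ψ'` -/

/-- The transition function of the monitor for `G ψ'`, where `c` is the class of `ψ'`. -/
noncomputable def monStep (c : Cls Ap) (p : Cls Ap × Cls Ap) (ν : Set Ap) : Cls Ap × Cls Ap :=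
  open Classical in
  if p.1.af ν = Cls.mk tt then ((p.2.af ν).conj c, Cls.mk tt)
  else (p.1.af ν, (p.2.af ν).conj c)

/-- The initial state `(ψ', tt)` of the monitor. -/
def monStart (c : Cls Ap) : Cls Ap × Cls Ap := (c, Cls.mk tt)

/-- The states of the monitor: the pairs reachable from its initial state. -/
def monReach (c : Cls Ap) : Set (Cls Ap × Cls Ap) :=
  {p | ∃ u : List (Set Ap), p = u.foldl (monStep c) (monStart c)}

/-- The transition of the monitor that leaves `p` with the letter `ν` is accepting. -/
def monAcc (p : Cls Ap × Cls Ap) (ν : Set Ap) : Prop := p.1.af ν = Cls.mk tt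

end LTL

/-! ### Limit-deterministic automata -/

/-- Automata over infinite words with `ε`-transitions (label `none`) and a generalized
transition-based Büchi acceptance condition. -/
structure BuchiAut (Al : Type*) where
  State : Type*
  start : State
  tr : State → Option Al → State → Prop
  Idx : Type*
  acc : Idx → Set (State × Option Al × State)

namespace BuchiAut

variable {Al : Type*}

/-- `ρ` is a run from `s` on the word `w`, with transition labels `l`: the letters among the labels
stand at the positions `f 0 < f 1 < ⋯` and spell `w`, all other labels are `ε`. -/
def IsRun (A : BuchiAut Al) (s : A.State) (w : ℕ → Al) (ρ : ℕ → A.State) (l : ℕ → Option Al) :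
    Prop :=
  ρ 0 = s ∧ (∀ n, A.tr (ρ n) (l n) (ρ (n + 1))) ∧
    ∃ f : ℕ → ℕ, StrictMono f ∧ (∀ k, l (f k) = some (w k)) ∧ ∀ n, n ∉ Set.range f → l n = none

/-- The language recognized from the state `s`: the words with a run from `s` that takes
transitions from each of the acceptance sets infinitely often. -/
def langFrom (A : BuchiAut Al) (s : A.State) : Set (ℕ → Al) :=
  {w | ∃ ρ l, A.IsRun s w ρ l ∧
    ∀ i : A.Idx, ∀ N, ∃ n ≥ N, (ρ n, l n, ρ (n + 1)) ∈ A.acc i}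

/-- `A` is limit-deterministic with deterministic part `Qd`. -/
structure IsLimitDet (A : BuchiAut Al) (Qd : Set A.State) : Prop where
  finite : Finite A.State
  start_notMem : A.start ∉ Qd
  acc_sub : ∀ i, ∀ t ∈ A.acc i, t.1 ∈ Qd ∧ t.2.2 ∈ Qd ∧ A.tr t.1 t.2.1 t.2.2
  det : ∀ q ∈ Qd, ∀ a q₁ q₂, A.tr q (some a) q₁ → A.tr q (some a) q₂ → q₁ = q₂
  no_eps : ∀ q ∈ Qd, ∀ q', ¬ A.tr q none q'
  trap : ∀ q ∈ Qd, ∀ a q', A.tr q a q' → q' ∈ Qd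

/-- The restriction of the transition relation to the complement of `Qd` is deterministic. -/
structure IsInitialDet (A : BuchiAut Al) (Qd : Set A.State) : Prop where
  det : ∀ q ∉ Qd, ∀ a, ∃! q', q' ∉ Qd ∧ A.tr q (some a) q'
  no_eps : ∀ q ∉ Qd, ∀ q' ∉ Qd, ¬ A.tr q none q'

end BuchiAut

/-! ### The automaton of a formula -/

namespace LTL

variable {Ap : Type*}

/-- States of the initial component: the classes reachable from `φ`. -/
def InState (φ : LTL Ap) : Type _ := {q : Cls Ap // q ∈ (Cls.mk φ).reach}

/-- States of the accepting component. A state of the subcomponent of `𝒢` consists of a state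
`main` of the monitor for `φ[𝒢]` (a class reachable from `χ[𝒢]` for some state `χ` of
the initial component) and of a state of the monitor for `G (ψ[𝒢])` for every `G ψ ∈ 𝒢`. -/
structure AcState (φ : LTL Ap) where
  G : GSet φ
  main : Cls Ap
  mon : {ψ : LTL Ap // glob ψ ∈ G.1} → Cls Ap × Cls Ap
  main_mem : ∃ χ : InState φ, main ∈ (Cls.atG G χ.1).reach
  mon_mem : ∀ i, mon i ∈ monReach (Cls.mk (atG G i.1))

/-- The transition function of the initial component. -/
noncomputable def inStep {φ : LTL Ap} (q : InState φ) (ν : Set Ap) : InState φ :=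
  ⟨q.1.af ν, by
    obtain ⟨u, hu⟩ := q.2
    exact ⟨u ++ [ν], by simp [hu]⟩⟩

/-- The transition function of the accepting component. -/
noncomputable def acStep {φ : LTL Ap} (s : AcState φ) (ν : Set Ap) : AcState φ where
  G := s.G
  main := s.main.af ν
  mon i := monStep (Cls.mk (atG s.G i.1)) (s.mon i) ν
  main_mem := by
    obtain ⟨χ, u, hu⟩ := s.main_mem
    exact ⟨χ, u ++ [ν], by simp [hu]⟩
  mon_mem i := by
    obtain ⟨u, hu⟩ := s.mon_mem i
    exact ⟨u ++ [ν], by simp [hu]⟩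

/-- The target of the `ε`-transition from the state `q` to the subcomponent of `𝒢`. -/
noncomputable def jump {φ : LTL Ap} (q : InState φ) (𝒢 : GSet φ) : AcState φ where
  G := 𝒢
  main := Cls.atG 𝒢 q.1
  mon i := monStart (Cls.mk (atG 𝒢 i.1))
  main_mem := ⟨q, [], rfl⟩
  mon_mem _ := ⟨[], rfl⟩

/-- The transition relation. -/
inductive Trans (φ : LTL Ap) :
    InState φ ⊕ AcState φ → Option (Set Ap) → InState φ ⊕ AcState φ → Prop
  | inStep (q : InState φ) (ν : Set Ap) : Trans φ (.inl q) (some ν) (.inl (inStep q ν))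
  | acStep (s : AcState φ) (ν : Set Ap) : Trans φ (.inr s) (some ν) (.inr (acStep s ν))
  | jump (q : InState φ) (𝒢 : GSet φ) : Trans φ (.inl q) none (.inr (jump q 𝒢))

/-- The limit-deterministic automaton of `φ`. There is one acceptance set for each `G`-subformula
`G ψ` of `φ`; in the subcomponent of `𝒢` it holds the transitions that leave a state with first
component `tt` and are accepting for the monitor of `G ψ` if `G ψ ∈ 𝒢`. The further index `none`
only asks for the first component `tt`; it matters only if `φ` has no `G`-subformulas. -/
noncomputable def ldba (φ : LTL Ap) : BuchiAut (Set Ap) where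
  State := InState φ ⊕ AcState φ
  start := .inl ⟨Cls.mk φ, [], rfl⟩
  tr := Trans φ
  Idx := Option {ψ : LTL Ap // glob ψ ∈ gsf φ}
  acc i := {t | ∃ (s : AcState φ) (ν : Set Ap), t = (.inr s, some ν, .inr (acStep s ν)) ∧
    s.main = Cls.mk tt ∧
    ∀ (j : {ψ : LTL Ap // glob ψ ∈ gsf φ}) (h : glob j.1 ∈ s.G.1),
      i = some j → monAcc (s.mon ⟨j.1, h⟩) ν}

/-- The states of the accepting component. -/
def acPart (φ : LTL Ap) : Set (ldba φ).State := Set.range (Sum.inr : AcState φ → _)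

end LTL

/-! Each state carries an obligation on the rest of the word, and the label writes it down. In the
initial component the obligation is the state's own formula, because `af` unfolds formulas exactly
(`sat_af`).

In the subcomponent of 𝒢 let F = `gsf φ \ 𝒢`. For a subformula ψ of φ no G survives in ψ[𝒢], so ψ[𝒢]
is prompt: it becomes tt after finitely many letters of any word that satisfies it. Hence the first
component q reaches tt iff the word satisfies it, and the monitor of Gψ in state (ξ₁, ξ₂) accepts
infinitely often iff ξ₁ and ξ₂ hold now and ψ[𝒢] holds at every suffix
(`infinitely_many_monAcc_iff`). The obligation is q together with all ξ₁, ξ₂ and G(ψ[𝒢]). The last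
conjunct is lost under the substitution [𝒢, F], which turns Gψ into tt, so the label uses [∅, F]
throughout. Satisfaction of the whole conjunction is unaffected: formulas in negation normal form
are monotone in the replaced parts (`sat_subst_mono`), and the conjuncts themselves guarantee the
formulas that were replaced by tt (`sat_subst_empty_left`).

A run that jumps and accepts proves q by undoing both replacements. Conversely, for a word
satisfying q, take 𝒢 to be the G-subformulas true at some suffix and jump once all of them hold;
from there on [𝒢] preserves truth (`exists_forall_ge_sat_iff_sat_atG`). Finiteness holds since all
classes involved are Boolean combinations of finitely many formulas ψ[T, F]. -/

namespace LTL

variable {Ap : Type*}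

/-- The suffix of the word `w` that starts at position `k`. -/
def suffix (w : ℕ → Set Ap) (k : ℕ) : ℕ → Set Ap := fun n => w (n + k)

@[simp] theorem suffix_zero (w : ℕ → Set Ap) : suffix w 0 = w := rfl

@[simp] theorem suffix_apply (w : ℕ → Set Ap) (k n : ℕ) : suffix w k n = w (n + k) := rfl

@[simp] theorem suffix_suffix (w : ℕ → Set Ap) (k j : ℕ) :
    suffix (suffix w k) j = suffix w (j + k) := by
  funext n; simp [add_assoc]

/-- Truth at a fixed word is itself a propositional valuation, so it respects propositional
equivalence and descends to classes. -/
theorem sat_iff_propEval (w : ℕ → Set Ap) (φ : LTL Ap) :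
    Sat φ w ↔ propEval (fun ψ => Sat ψ w) φ := by
  induction φ <;> simp_all [Sat, propEval]

theorem sat_conj {φ ψ : LTL Ap} {w : ℕ → Set Ap} : Sat (conj φ ψ) w ↔ Sat φ w ∧ Sat ψ w := Iff.rfl

theorem sat_next {φ : LTL Ap} {w : ℕ → Set Ap} : Sat (next φ) w ↔ Sat φ (suffix w 1) := Iff.rfl

theorem sat_ev {φ : LTL Ap} {w : ℕ → Set Ap} : Sat (ev φ) w ↔ ∃ k, Sat φ (suffix w k) := Iff.rfl

theorem sat_glob {φ : LTL Ap} {w : ℕ → Set Ap} : Sat (glob φ) w ↔ ∀ k, Sat φ (suffix w k) :=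
  Iff.rfl

theorem sat_untl {φ ψ : LTL Ap} {w : ℕ → Set Ap} :
    Sat (untl φ ψ) w ↔ ∃ k, Sat ψ (suffix w k) ∧ ∀ j < k, Sat φ (suffix w j) := Iff.rfl

theorem sat_af (w : ℕ → Set Ap) (φ : LTL Ap) : Sat (af φ (w 0)) (suffix w 1) ↔ Sat φ w := by
  induction φ with
  | tt => simp [af, Sat]
  | ff => simp [af, Sat]
  | lit a => by_cases h : a ∈ w 0 <;> simp [af, Sat, h]
  | nlit a => by_cases h : a ∈ w 0 <;> simp [af, Sat, h]
  | conj φ ψ h1 h2 => simp [af, Sat, h1, h2]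
  | disj φ ψ h1 h2 => simp [af, Sat, h1, h2]
  | next φ h => exact sat_next.symm
  | ev φ h =>
    rw [af, Sat, h, sat_ev, sat_ev]
    simp only [suffix_suffix]
    constructor
    · rintro (h | ⟨k, hk⟩)
      exacts [⟨0, h⟩, ⟨_, hk⟩]
    · rintro ⟨_ | k, hk⟩
      exacts [.inl hk, .inr ⟨k, hk⟩]
  | glob φ h =>
    rw [af, Sat, h, sat_glob, sat_glob]
    simp only [suffix_suffix]
    constructor
    · rintro ⟨h, hk⟩ (_ | k)
      exacts [h, hk k]
    · exact fun hk => ⟨hk 0, fun k => hk (k + 1)⟩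
  | untl φ ψ h1 h2 =>
    rw [af, Sat, Sat, h1, h2, sat_untl, sat_untl]
    simp only [suffix_suffix]
    constructor
    · rintro (h | ⟨h, k, hk, hj⟩)
      · exact ⟨0, h, by simp⟩
      · refine ⟨k + 1, hk, ?_⟩
        rintro (_ | j) hjk
        exacts [h, hj j (by omega)]
    · rintro ⟨_ | k, hk, hj⟩
      · exact .inl hk
      · exact .inr ⟨hj 0 (by omega), k, hk, fun j h => hj (j + 1) (by omega)⟩

/-! ### Classes of formulas -/

namespace Cls

/-- Satisfaction of a class of formulas by a word. -/
def Sat (c : Cls Ap) (w : ℕ → Set Ap) : Prop :=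
  Quotient.lift (fun φ => LTL.Sat φ w)
    (fun φ ψ h => propext (by
      rw [sat_iff_propEval w φ, sat_iff_propEval w ψ]; exact h _)) c

@[simp] theorem sat_mk (φ : LTL Ap) (w : ℕ → Set Ap) : (mk φ).Sat w ↔ LTL.Sat φ w := Iff.rfl

theorem mk_surjective (c : Cls Ap) : ∃ φ, c = mk φ := by
  obtain ⟨φ, h⟩ := Quotient.exists_rep c
  exact ⟨φ, h.symm⟩

theorem mk_eq_mk {φ ψ : LTL Ap} : mk φ = mk ψ ↔ ∀ v, propEval v φ ↔ propEval v ψ :=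
  Quotient.eq

theorem mk_eq_tt {φ : LTL Ap} : mk φ = mk tt ↔ ∀ v, propEval v φ := by
  simp [mk_eq_mk, propEval]

@[simp] theorem af_mk (φ : LTL Ap) (ν : Set Ap) : (mk φ).af ν = mk (LTL.af φ ν) := rfl

@[simp] theorem conj_mk (φ ψ : LTL Ap) : (mk φ).conj (mk ψ) = mk (LTL.conj φ ψ) := rfl

@[simp] theorem atG_mk {φ : LTL Ap} (𝒢 : GSet φ) (ψ : LTL Ap) :
    Cls.atG 𝒢 (mk ψ) = mk (LTL.atG 𝒢 ψ) := rfl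

@[simp] theorem sat_conj (c d : Cls Ap) (w : ℕ → Set Ap) :
    (c.conj d).Sat w ↔ c.Sat w ∧ d.Sat w := by
  obtain ⟨φ, rfl⟩ := c.mk_surjective
  obtain ⟨ψ, rfl⟩ := d.mk_surjective
  rfl

theorem sat_af (c : Cls Ap) (w : ℕ → Set Ap) : (c.af (w 0)).Sat (suffix w 1) ↔ c.Sat w := by
  obtain ⟨φ, rfl⟩ := c.mk_surjective
  exact LTL.sat_af w φ

theorem sat_af_suffix (c : Cls Ap) (w : ℕ → Set Ap) (n : ℕ) :
    (c.af (w n)).Sat (suffix w (n + 1)) ↔ c.Sat (suffix w n) := by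
  have h := c.sat_af (suffix w n)
  rwa [suffix_suffix, suffix_apply, zero_add, add_comm 1 n] at h

/-- The class reached from `c` after the first `n` letters of `w`. -/
noncomputable def afWord (c : Cls Ap) (w : ℕ → Set Ap) : ℕ → Cls Ap
  | 0 => c
  | n + 1 => (afWord c w n).af (w n)

@[simp] theorem afWord_zero (c : Cls Ap) (w : ℕ → Set Ap) : c.afWord w 0 = c := rfl

theorem afWord_succ (c : Cls Ap) (w : ℕ → Set Ap) (n : ℕ) :
    c.afWord w (n + 1) = (c.afWord w n).af (w n) := rfl

/-- Splits off the first letter instead of the last; this is the form needed to unfold X, F and U.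
-/
theorem afWord_succ' (c : Cls Ap) (w : ℕ → Set Ap) (n : ℕ) :
    c.afWord w (n + 1) = (c.af (w 0)).afWord (suffix w 1) n := by
  induction n with
  | zero => rfl
  | succ n ih => rw [afWord_succ, ih]; rfl

theorem sat_afWord (c : Cls Ap) (w : ℕ → Set Ap) (n : ℕ) :
    (c.afWord w n).Sat (suffix w n) ↔ c.Sat w := by
  induction n with
  | zero => rfl
  | succ n ih => rw [afWord_succ, sat_af_suffix, ih]

theorem afWord_conj (c d : Cls Ap) (w : ℕ → Set Ap) (n : ℕ) :
    (c.conj d).afWord w n = (c.afWord w n).conj (d.afWord w n) := by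
  induction n with
  | zero => rfl
  | succ n ih =>
    rw [afWord_succ, ih, afWord_succ, afWord_succ]
    obtain ⟨φ, h⟩ := (c.afWord w n).mk_surjective
    obtain ⟨ψ, h'⟩ := (d.afWord w n).mk_surjective
    rw [h, h']; rfl

theorem afWord_eq_tt_mono {c : Cls Ap} {w : ℕ → Set Ap} {m n : ℕ} (hmn : m ≤ n)
    (h : c.afWord w m = mk tt) : c.afWord w n = mk tt := by
  induction n, hmn using Nat.le_induction with
  | base => exact h
  | succ n _ ih => rw [afWord_succ, ih]; rfl

theorem sat_of_afWord_eq_tt {c : Cls Ap} {w : ℕ → Set Ap} {n : ℕ}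
    (h : c.afWord w n = mk tt) : c.Sat w := by
  rw [← sat_afWord c w n, h]; trivial

/-- A class is prompt if it becomes `tt` along every word that satisfies it. -/
def Prompt (c : Cls Ap) : Prop := ∀ w, c.Sat w → ∃ n, c.afWord w n = mk tt

theorem Prompt.conj {c d : Cls Ap} (hc : c.Prompt) (hd : d.Prompt) : (c.conj d).Prompt := by
  intro w h
  rw [sat_conj] at h
  obtain ⟨m, hm⟩ := hc w h.1
  obtain ⟨n, hn⟩ := hd w h.2
  refine ⟨max m n, ?_⟩
  rw [afWord_conj, afWord_eq_tt_mono (le_max_left m n) hm,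
    afWord_eq_tt_mono (le_max_right m n) hn, conj_mk, mk_eq_tt]
  exact fun v => ⟨trivial, trivial⟩

theorem Prompt.af {c : Cls Ap} (hc : c.Prompt) (ν : Set Ap) : (c.af ν).Prompt := by
  intro w h
  -- The word νw: it satisfies `c`, and `c` becomes tt along it; one more letter does no harm, since
  -- tt is absorbing.
  let w' : ℕ → Set Ap := fun n => Nat.casesOn n ν w
  have hw : suffix w' 1 = w := rfl
  obtain ⟨n, hn⟩ := hc w' ((sat_af c w').1 h)
  refine ⟨n, ?_⟩
  have := afWord_eq_tt_mono (Nat.le_succ n) hn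
  rwa [Nat.succ_eq_add_one, afWord_succ'] at this

theorem prompt_tt : (mk (tt : LTL Ap)).Prompt := fun _ _ => ⟨0, rfl⟩

theorem prompt_ff : (mk (ff : LTL Ap)).Prompt := fun _ h => h.elim

theorem prompt_lit (a : Ap) : (mk (lit a)).Prompt := fun w (h : a ∈ w 0) =>
  ⟨1, by simp [afWord_succ, LTL.af, h]⟩

theorem prompt_nlit (a : Ap) : (mk (nlit a)).Prompt := fun w (h : a ∉ w 0) =>
  ⟨1, by simp [afWord_succ, LTL.af, h]⟩

theorem afWord_disj_eq_tt {φ ψ : LTL Ap} {w : ℕ → Set Ap} {n : ℕ}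
    (h : (mk φ).afWord w n = mk tt ∨ (mk ψ).afWord w n = mk tt) :
    (mk (disj φ ψ)).afWord w n = mk tt := by
  -- Disjunction is not defined on classes, so representatives of both disjuncts are carried along
  -- the word.
  have key : ∀ n, ∃ φ' ψ', (mk φ).afWord w n = mk φ' ∧ (mk ψ).afWord w n = mk ψ' ∧
      (mk (disj φ ψ)).afWord w n = mk (disj φ' ψ') := by
    intro n
    induction n with
    | zero => exact ⟨φ, ψ, rfl, rfl, rfl⟩
    | succ n ih =>
      obtain ⟨φ', ψ', h1, h2, h3⟩ := ih
      exact ⟨LTL.af φ' (w n), LTL.af ψ' (w n), by rw [afWord_succ, h1, af_mk],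
        by rw [afWord_succ, h2, af_mk], by rw [afWord_succ, h3, af_mk, LTL.af]⟩
  obtain ⟨φ', ψ', h1, h2, h3⟩ := key n
  rw [h1, h2] at h
  rw [h3, mk_eq_tt]
  intro v
  exact h.imp (fun h => mk_eq_tt.1 h v) (fun h => mk_eq_tt.1 h v)

theorem Prompt.disj {φ ψ : LTL Ap} (hφ : (mk φ).Prompt) (hψ : (mk ψ).Prompt) :
    (mk (disj φ ψ)).Prompt := by
  rintro w (h | h)
  · exact (hφ w h).imp fun n hn => afWord_disj_eq_tt (.inl hn)
  · exact (hψ w h).imp fun n hn => afWord_disj_eq_tt (.inr hn)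

theorem Prompt.next {φ : LTL Ap} (hφ : (mk φ).Prompt) : (mk (next φ)).Prompt := by
  intro w h
  obtain ⟨n, hn⟩ := hφ (suffix w 1) h
  exact ⟨n + 1, by rw [afWord_succ']; exact hn⟩

/-- Unfolding Fφ spawns a copy of φ at each position, and the copy at the witness becomes tt. There
is no analogue for G: Gφ stays a conjunct forever and never becomes tt. -/
theorem Prompt.ev {φ : LTL Ap} (hφ : (mk φ).Prompt) : (mk (ev φ)).Prompt := by
  rintro w ⟨k, hk⟩
  induction k generalizing w with
  | zero =>
    obtain ⟨n, hn⟩ := hφ w hk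
    refine ⟨n + 1, ?_⟩
    rw [afWord_succ']
    refine afWord_disj_eq_tt (.inl ?_)
    rw [← af_mk, ← afWord_succ']
    exact afWord_eq_tt_mono n.le_succ hn
  | succ k ih =>
    obtain ⟨n, hn⟩ := ih (suffix w 1) hk
    refine ⟨n + 1, ?_⟩
    rw [afWord_succ']
    exact afWord_disj_eq_tt (.inr hn)

theorem Prompt.untl {φ ψ : LTL Ap} (hφ : (mk φ).Prompt) (hψ : (mk ψ).Prompt) :
    (mk (untl φ ψ)).Prompt := by
  rintro w ⟨k, hk, hj⟩
  induction k generalizing w with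
  | zero =>
    obtain ⟨n, hn⟩ := hψ w hk
    refine ⟨n + 1, ?_⟩
    rw [afWord_succ']
    refine afWord_disj_eq_tt (.inl ?_)
    rw [← af_mk, ← afWord_succ']
    exact afWord_eq_tt_mono n.le_succ hn
  | succ k ih =>
    obtain ⟨n, hn⟩ := ih (suffix w 1) hk fun j h => hj (j + 1) (by omega)
    obtain ⟨m, hm⟩ := hφ w (hj 0 (by omega))
    refine ⟨max m n + 1, ?_⟩
    rw [afWord_succ']
    refine afWord_disj_eq_tt (.inr ?_)
    rw [← conj_mk, afWord_conj, afWord_eq_tt_mono (le_max_right m n) hn, ← af_mk,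
      ← afWord_succ', afWord_eq_tt_mono ((le_max_left m n).trans (Nat.le_succ _)) hm,
      conj_mk, mk_eq_tt]
    exact fun v => ⟨trivial, trivial⟩

end Cls

/-! ### Monitors -/

/-- The state reached by the monitor from `p` after the first `n` letters of `w`. -/
noncomputable def monRun (c : Cls Ap) (p : Cls Ap × Cls Ap) (w : ℕ → Set Ap) :
    ℕ → Cls Ap × Cls Ap
  | 0 => p
  | n + 1 => monStep c (monRun c p w n) (w n)

theorem monRun_succ_of_acc {c : Cls Ap} {p : Cls Ap × Cls Ap} {w : ℕ → Set Ap} {n : ℕ}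
    (h : monAcc (monRun c p w n) (w n)) :
    monRun c p w (n + 1) = (((monRun c p w n).2.af (w n)).conj c, Cls.mk tt) := if_pos h

theorem monRun_succ_of_not_acc {c : Cls Ap} {p : Cls Ap × Cls Ap} {w : ℕ → Set Ap} {n : ℕ}
    (h : ¬ monAcc (monRun c p w n) (w n)) :
    monRun c p w (n + 1) =
      ((monRun c p w n).1.af (w n), ((monRun c p w n).2.af (w n)).conj c) := if_neg h

theorem prompt_monStep {c : Cls Ap} (hc : c.Prompt) {p : Cls Ap × Cls Ap}
    (hp : p.1.Prompt ∧ p.2.Prompt) (ν : Set Ap) :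
    (monStep c p ν).1.Prompt ∧ (monStep c p ν).2.Prompt := by
  unfold monStep
  split_ifs
  · exact ⟨(hp.2.af ν).conj hc, Cls.prompt_tt⟩
  · exact ⟨hp.1.af ν, (hp.2.af ν).conj hc⟩

theorem prompt_monRun {c : Cls Ap} (hc : c.Prompt) {p : Cls Ap × Cls Ap}
    (hp : p.1.Prompt ∧ p.2.Prompt) (w : ℕ → Set Ap) (n : ℕ) :
    (monRun c p w n).1.Prompt ∧ (monRun c p w n).2.Prompt := by
  induction n with
  | zero => exact hp
  | succ n ih => exact prompt_monStep hc ih _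

theorem prompt_of_mem_monReach {c : Cls Ap} (hc : c.Prompt) {p : Cls Ap × Cls Ap}
    (hp : p ∈ monReach c) : p.1.Prompt ∧ p.2.Prompt := by
  obtain ⟨u, rfl⟩ := hp
  induction u using List.reverseRecOn with
  | nil => exact ⟨hc, Cls.prompt_tt⟩
  | append_singleton u ν ih =>
    rw [List.foldl_append]
    exact prompt_monStep hc ih ν

/-- Every step conjoins a fresh copy of `c` to one of the two components, and the initial state has
it in the first. -/
theorem sat_of_mem_monReach {c : Cls Ap} {p : Cls Ap × Cls Ap} (hp : p ∈ monReach c)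
    {w : ℕ → Set Ap} (h1 : p.1.Sat w) (h2 : p.2.Sat w) : c.Sat w := by
  obtain ⟨u, rfl⟩ := hp
  induction u using List.reverseRecOn with
  | nil => exact h1
  | append_singleton u ν _ =>
    rw [List.foldl_append, List.foldl_cons, List.foldl_nil, monStep] at h1 h2
    split_ifs at h1 h2
    · exact ((Cls.sat_conj _ _ _).1 h1).2
    · exact ((Cls.sat_conj _ _ _).1 h2).2

theorem sat_monRun {c : Cls Ap} {p : Cls Ap × Cls Ap} {w : ℕ → Set Ap}
    (h1 : p.1.Sat w) (h2 : p.2.Sat w) (hc : ∀ k, c.Sat (suffix w (k + 1))) (n : ℕ) :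
    (monRun c p w n).1.Sat (suffix w n) ∧ (monRun c p w n).2.Sat (suffix w n) := by
  induction n with
  | zero => exact ⟨h1, h2⟩
  | succ n ih =>
    by_cases h : monAcc (monRun c p w n) (w n)
    · rw [monRun_succ_of_acc h, Cls.sat_conj, Cls.sat_af_suffix]
      exact ⟨⟨ih.2, hc n⟩, trivial⟩
    · rw [monRun_succ_of_not_acc h, Cls.sat_conj, Cls.sat_af_suffix, Cls.sat_af_suffix]
      exact ⟨ih.1, ih.2, hc n⟩

/-- Up to the next accepting transition the first component evolves by `af` alone, and there it
becomes tt; satisfaction is pulled back along these steps. -/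
theorem sat_fst_of_monAcc {c : Cls Ap} {p : Cls Ap × Cls Ap} {w : ℕ → Set Ap} (d n : ℕ)
    (h : monAcc (monRun c p w (n + d)) (w (n + d))) :
    (monRun c p w n).1.Sat (suffix w n) := by
  induction d generalizing n with
  | zero =>
    rw [← Cls.sat_af_suffix, show (monRun c p w n).1.af (w n) = Cls.mk tt from h]
    trivial
  | succ d ih =>
    by_cases h' : monAcc (monRun c p w n) (w n)
    · rw [← Cls.sat_af_suffix, show (monRun c p w n).1.af (w n) = Cls.mk tt from h']
      trivial
    · have := ih (n + 1) (by rwa [add_right_comm, add_assoc])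
      rwa [monRun_succ_of_not_acc h', Cls.sat_af_suffix] at this

theorem sat_of_infinitely_many_monAcc {c : Cls Ap} {p : Cls Ap × Cls Ap} {w : ℕ → Set Ap}
    (h : ∀ N, ∃ n ≥ N, monAcc (monRun c p w n) (w n)) (n : ℕ) :
    (monRun c p w n).1.Sat (suffix w n) ∧ (monRun c p w n).2.Sat (suffix w n) := by
  have hfst : ∀ n, (monRun c p w n).1.Sat (suffix w n) := by
    intro n
    obtain ⟨m, hm, hacc⟩ := h n
    obtain ⟨d, rfl⟩ := Nat.exists_eq_add_of_le hm
    exact sat_fst_of_monAcc d n hacc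
  refine ⟨hfst n, ?_⟩
  -- The second component is only enlarged by conjuncts until the next accepting transition moves it
  -- to the first place, where `hfst` applies.
  obtain ⟨m, hm, hacc⟩ := h n
  obtain ⟨d, rfl⟩ := Nat.exists_eq_add_of_le hm
  clear hm
  induction d generalizing n with
  | zero =>
    have := hfst (n + 1)
    rw [monRun_succ_of_acc hacc, Cls.sat_conj, Cls.sat_af_suffix] at this
    exact this.1
  | succ d ih =>
    by_cases h' : monAcc (monRun c p w n) (w n)
    · have := hfst (n + 1)
      rw [monRun_succ_of_acc h', Cls.sat_conj, Cls.sat_af_suffix] at this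
      exact this.1
    · have := ih (n + 1) (by rwa [add_right_comm, add_assoc])
      rw [monRun_succ_of_not_acc h', Cls.sat_conj, Cls.sat_af_suffix] at this
      exact this.1

theorem infinitely_many_monAcc_iff {c : Cls Ap} (hc : c.Prompt) {p : Cls Ap × Cls Ap}
    (hp : p ∈ monReach c) (w : ℕ → Set Ap) :
    (∀ N, ∃ n ≥ N, monAcc (monRun c p w n) (w n)) ↔
      p.1.Sat w ∧ p.2.Sat w ∧ ∀ k, c.Sat (suffix w k) := by
  constructor
  · intro h
    have hs := sat_of_infinitely_many_monAcc h
    refine ⟨(hs 0).1, (hs 0).2, ?_⟩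
    rintro (_ | k)
    · exact sat_of_mem_monReach hp (hs 0).1 (hs 0).2
    · have := hs (k + 1)
      by_cases h' : monAcc (monRun c p w k) (w k)
      · rw [monRun_succ_of_acc h', Cls.sat_conj] at this
        exact this.1.2
      · rw [monRun_succ_of_not_acc h', Cls.sat_conj] at this
        exact this.2.2
  · rintro ⟨h1, h2, hk⟩ N
    by_contra! hN
    -- Without accepting transitions from N on, the first component is only rewritten by `af`; being
    -- prompt and satisfied, it is tt after m letters, and the next transition accepts.
    obtain ⟨m, hm⟩ := (prompt_monRun hc (prompt_of_mem_monReach hc hp) w N).1 _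
      (sat_monRun h1 h2 (fun k => hk (k + 1)) N).1
    have key : ∀ j, (monRun c p w (N + j)).1 = (monRun c p w N).1.afWord (suffix w N) j := by
      intro j
      induction j with
      | zero => rfl
      | succ j ih =>
        rw [← add_assoc, monRun_succ_of_not_acc (hN _ (by omega)), Cls.afWord_succ, ih,
          suffix_apply, add_comm j N]
    refine hN (N + m) (by omega) ?_
    rw [monAcc, key, hm]
    rfl

/-! ### Subformulas and substitution -/

theorem mem_sf_self (φ : LTL Ap) : φ ∈ sf φ := by
  cases φ <;> simp [sf]

theorem sf_subset_of_mem {φ ψ : LTL Ap} (h : ψ ∈ sf φ) : sf ψ ⊆ sf φ := by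
  induction φ with
  | tt | ff | lit a | nlit a =>
    obtain rfl : ψ = _ := h
    exact subset_rfl
  | conj φ₁ φ₂ h1 h2 | disj φ₁ φ₂ h1 h2 | untl φ₁ φ₂ h1 h2 =>
    rcases h with rfl | h | h
    · exact subset_rfl
    · exact fun χ hχ => .inr (.inl (h1 h hχ))
    · exact fun χ hχ => .inr (.inr (h2 h hχ))
  | next φ₁ h1 | ev φ₁ h1 | glob φ₁ h1 =>
    rcases h with rfl | h
    · exact subset_rfl
    · exact fun χ hχ => .inr (h1 h hχ)

theorem finite_sf (φ : LTL Ap) : (sf φ).Finite := by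
  induction φ <;> simp_all [sf]

theorem finite_gsf (φ : LTL Ap) : (gsf φ).Finite := (finite_sf φ).subset fun _ h => h.1

theorem mem_sf_of_glob_mem {φ ψ : LTL Ap} (h : glob ψ ∈ sf φ) : ψ ∈ sf φ :=
  sf_subset_of_mem h (.inr (mem_sf_self ψ))

/-- A set of formulas of the form `G ψ`. -/
def IsGlobSet (T : Set (LTL Ap)) : Prop := ∀ χ ∈ T, ∃ ψ, χ = glob ψ

theorem isGlobSet_empty : IsGlobSet (∅ : Set (LTL Ap)) := fun _ h => h.elim

theorem GSet.isGlobSet {φ : LTL Ap} (𝒢 : GSet φ) : IsGlobSet 𝒢.1 := fun _ h => (𝒢.2 h).2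

theorem GSet.isGlobSet_compl {φ : LTL Ap} (𝒢 : GSet φ) : IsGlobSet (gsf φ \ 𝒢.1) :=
  fun _ h => h.1.2

theorem replace_of_mem_left {T F : Set (LTL Ap)} {χ : LTL Ap} (h : χ ∈ T) (χ' : LTL Ap) :
    replace T F χ χ' = tt := if_pos h

theorem replace_of_mem_right {T F : Set (LTL Ap)} {χ : LTL Ap} (h : χ ∉ T) (h' : χ ∈ F)
    (χ' : LTL Ap) : replace T F χ χ' = ff := (if_neg h).trans (if_pos h')

theorem replace_of_notMem {T F : Set (LTL Ap)} {χ : LTL Ap} (h : χ ∉ T) (h' : χ ∉ F)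
    (χ' : LTL Ap) : replace T F χ χ' = χ' := (if_neg h).trans (if_neg h')

theorem replace_of_ne_glob {T F : Set (LTL Ap)} (hT : IsGlobSet T) (hF : IsGlobSet F)
    {χ : LTL Ap} (h : ∀ ψ, χ ≠ glob ψ) (χ' : LTL Ap) : replace T F χ χ' = χ' :=
  replace_of_notMem (fun hm => (hT χ hm).elim h) (fun hm => (hF χ hm).elim h) χ'

@[simp] theorem subst_empty (φ : LTL Ap) : subst ∅ ∅ φ = φ := by
  induction φ <;> simp_all [subst, replace]

section

variable {T F : Set (LTL Ap)}

theorem subst_tt (hT : IsGlobSet T) (hF : IsGlobSet F) : subst T F tt = tt :=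
  replace_of_ne_glob hT hF (by simp) _

theorem subst_ff (hT : IsGlobSet T) (hF : IsGlobSet F) : subst T F ff = ff :=
  replace_of_ne_glob hT hF (by simp) _

theorem subst_lit (hT : IsGlobSet T) (hF : IsGlobSet F) (a : Ap) :
    subst T F (lit a) = lit a := replace_of_ne_glob hT hF (by simp) _

theorem subst_nlit (hT : IsGlobSet T) (hF : IsGlobSet F) (a : Ap) :
    subst T F (nlit a) = nlit a := replace_of_ne_glob hT hF (by simp) _

theorem subst_conj (hT : IsGlobSet T) (hF : IsGlobSet F) (φ ψ : LTL Ap) :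
    subst T F (conj φ ψ) = conj (subst T F φ) (subst T F ψ) :=
  replace_of_ne_glob hT hF (by simp) _

theorem subst_disj (hT : IsGlobSet T) (hF : IsGlobSet F) (φ ψ : LTL Ap) :
    subst T F (disj φ ψ) = disj (subst T F φ) (subst T F ψ) :=
  replace_of_ne_glob hT hF (by simp) _

theorem subst_next (hT : IsGlobSet T) (hF : IsGlobSet F) (φ : LTL Ap) :
    subst T F (next φ) = next (subst T F φ) := replace_of_ne_glob hT hF (by simp) _

theorem subst_ev (hT : IsGlobSet T) (hF : IsGlobSet F) (φ : LTL Ap) :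
    subst T F (ev φ) = ev (subst T F φ) := replace_of_ne_glob hT hF (by simp) _

theorem subst_glob_of_mem_left {φ : LTL Ap} (h : glob φ ∈ T) : subst T F (glob φ) = tt :=
  replace_of_mem_left h _

theorem subst_glob_of_mem_right {φ : LTL Ap} (h : glob φ ∉ T) (h' : glob φ ∈ F) :
    subst T F (glob φ) = ff := replace_of_mem_right h h' _

theorem subst_glob_of_notMem {φ : LTL Ap} (h : glob φ ∉ T) (h' : glob φ ∉ F) :
    subst T F (glob φ) = glob (subst T F φ) := replace_of_notMem h h' _

theorem subst_untl (hT : IsGlobSet T) (hF : IsGlobSet F) (φ ψ : LTL Ap) :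
    subst T F (untl φ ψ) = untl (subst T F φ) (subst T F ψ) :=
  replace_of_ne_glob hT hF (by simp) _

end

/-! ### Semantics of substitution -/

theorem sat_replace_iff {T F : Set (LTL Ap)} {χ χ' : LTL Ap} {w : ℕ → Set Ap} :
    Sat (replace T F χ χ') w ↔ χ ∈ T ∨ χ ∉ F ∧ Sat χ' w := by
  unfold replace
  split_ifs <;> simp_all [Sat]

theorem sat_suffix_next {φ : LTL Ap} {w : ℕ → Set Ap} {k : ℕ} :
    Sat (next φ) (suffix w k) ↔ Sat φ (suffix w (1 + k)) := by
  rw [sat_next, suffix_suffix]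

theorem sat_suffix_ev {φ : LTL Ap} {w : ℕ → Set Ap} {k : ℕ} :
    Sat (ev φ) (suffix w k) ↔ ∃ m, Sat φ (suffix w (m + k)) := by
  simp only [sat_ev, suffix_suffix]

theorem sat_suffix_glob {φ : LTL Ap} {w : ℕ → Set Ap} {k : ℕ} :
    Sat (glob φ) (suffix w k) ↔ ∀ m, Sat φ (suffix w (m + k)) := by
  simp only [sat_glob, suffix_suffix]

theorem sat_suffix_untl {φ ψ : LTL Ap} {w : ℕ → Set Ap} {k : ℕ} :
    Sat (untl φ ψ) (suffix w k) ↔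
      ∃ m, Sat ψ (suffix w (m + k)) ∧ ∀ j < m, Sat φ (suffix w (j + k)) := by
  simp only [sat_untl, suffix_suffix]

theorem sat_subst_iff {T F : Set (LTL Ap)} {w : ℕ → Set Ap}
    (hT : ∀ χ ∈ T, ∀ k, Sat χ (suffix w k)) (hF : ∀ χ ∈ F, ∀ k, ¬ Sat χ (suffix w k))
    (ψ : LTL Ap) (k : ℕ) : Sat (subst T F ψ) (suffix w k) ↔ Sat ψ (suffix w k) := by
  have key : ∀ (χ χ' : LTL Ap) (k : ℕ), (Sat χ' (suffix w k) ↔ Sat χ (suffix w k)) →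
      (Sat (replace T F χ χ') (suffix w k) ↔ Sat χ (suffix w k)) := by
    intro χ χ' k h
    rw [sat_replace_iff, h]
    constructor
    · rintro (h | h)
      exacts [hT χ h k, h.2]
    · exact fun h => .inr ⟨fun hm => hF χ hm k h, h⟩
  induction ψ generalizing k with
  | tt | ff | lit a | nlit a => exact key _ _ k Iff.rfl
  | conj φ ψ h1 h2 | disj φ ψ h1 h2 => exact key _ _ k (by simp only [Sat, h1, h2])
  | next φ h => exact key _ _ k (by simp only [sat_suffix_next, h])
  | ev φ h => exact key _ _ k (by simp only [sat_suffix_ev, h])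
  | glob φ h => exact key _ _ k (by simp only [sat_suffix_glob, h])
  | untl φ ψ h1 h2 => exact key _ _ k (by simp only [sat_suffix_untl, h1, h2])

/-- In negation normal form every connective is monotone in its arguments. -/
theorem sat_subst_mono {T T' F F' : Set (LTL Ap)} (hT : T' ⊆ T) (hF : F ⊆ F') (ψ : LTL Ap)
    (w : ℕ → Set Ap) (h : Sat (subst T' F' ψ) w) : Sat (subst T F ψ) w := by
  have key : ∀ (χ χ₁ χ₂ : LTL Ap) (w : ℕ → Set Ap), (Sat χ₁ w → Sat χ₂ w) →
      Sat (replace T' F' χ χ₁) w → Sat (replace T F χ χ₂) w := by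
    intro χ χ₁ χ₂ w h
    rw [sat_replace_iff, sat_replace_iff]
    exact Or.imp (fun h => hT h) (And.imp (fun h h' => h (hF h')) h)
  induction ψ generalizing w with
  | tt | ff | lit a | nlit a => exact key _ _ _ w id h
  | conj φ ψ h1 h2 => exact key _ (conj (subst T' F' φ) (subst T' F' ψ)) _ w (And.imp (h1 w) (h2 w)) h
  | disj φ ψ h1 h2 => exact key _ (disj (subst T' F' φ) (subst T' F' ψ)) _ w (Or.imp (h1 w) (h2 w)) h
  | next φ h1 => exact key _ (next (subst T' F' φ)) _ w (h1 _) h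
  | ev φ h1 => exact key _ (ev (subst T' F' φ)) _ w (fun ⟨k, hk⟩ => ⟨k, h1 _ hk⟩) h
  | glob φ h1 => exact key _ (glob (subst T' F' φ)) _ w (fun hk k => h1 _ (hk k)) h
  | untl φ ψ h1 h2 =>
    exact key _ (untl (subst T' F' φ) (subst T' F' ψ)) _ w (fun ⟨k, hk, hj⟩ =>
      ⟨k, h2 _ hk, fun j hjk => h1 _ (hj j hjk)⟩) h

/-- The apparent circularity, in that `h` already assumes the replacements by tt, is resolved by
structural induction: for Gψ in T the claim for the smaller ψ turns `h` into the truth of G(ψ[∅,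
F]), so replacing Gψ by tt changes nothing. Disjointness keeps Gψ from being replaced by ff on the
left. -/
theorem sat_subst_empty_left {T F : Set (LTL Ap)} {w : ℕ → Set Ap} (hT : IsGlobSet T)
    (hTF : Disjoint T F) (h : ∀ ψ, glob ψ ∈ T → ∀ k, Sat (subst T F ψ) (suffix w k))
    (χ : LTL Ap) (k : ℕ) :
    Sat (subst ∅ F χ) (suffix w k) ↔ Sat (subst T F χ) (suffix w k) := by
  have key : ∀ (χ χ₁ χ₂ : LTL Ap) (k : ℕ), (χ ∈ T → Sat χ₁ (suffix w k)) →
      (Sat χ₁ (suffix w k) ↔ Sat χ₂ (suffix w k)) →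
      (Sat (replace ∅ F χ χ₁) (suffix w k) ↔ Sat (replace T F χ χ₂) (suffix w k)) := by
    intro χ χ₁ χ₂ k h1 h2
    rw [sat_replace_iff, sat_replace_iff, ← h2, Set.mem_empty_iff_false, false_or]
    constructor
    · exact .inr
    · rintro (h | h)
      exacts [⟨fun h' => hTF.le_bot ⟨h, h'⟩, h1 h⟩, h]
  have hne : ∀ χ, (∀ ψ, χ ≠ glob ψ) → χ ∉ T := fun χ hχ hm => (hT χ hm).elim hχ
  induction χ generalizing k with
  | tt | ff | lit a | nlit a => exact key _ _ _ k (fun h => (hne _ (by simp) h).elim) Iff.rfl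
  | conj φ ψ h1 h2 | disj φ ψ h1 h2 =>
    exact key _ _ _ k (fun h => (hne _ (by simp) h).elim) (by simp only [Sat, h1, h2])
  | next φ h1 =>
    exact key _ _ _ k (fun h => (hne _ (by simp) h).elim) (by simp only [sat_suffix_next, h1])
  | ev φ h1 =>
    exact key _ _ _ k (fun h => (hne _ (by simp) h).elim) (by simp only [sat_suffix_ev, h1])
  | glob φ h1 =>
    refine key _ _ _ k (fun hm => ?_) (by simp only [sat_suffix_glob, h1])
    rw [sat_suffix_glob]
    exact fun m => (h1 _).2 (h φ hm _)
  | untl φ ψ h1 h2 =>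
    exact key _ _ _ k (fun h => (hne _ (by simp) h).elim)
      (by simp only [sat_suffix_untl, h1, h2])

/-! ### Boolean combinations -/

theorem IsBoolComb.subst {S T F : Set (LTL Ap)} (hT : IsGlobSet T) (hF : IsGlobSet F)
    {θ : LTL Ap} (h : IsBoolComb S θ) :
    IsBoolComb {χ | ∃ ψ ∈ S, χ = LTL.subst T F ψ} (LTL.subst T F θ) := by
  induction h with
  | base ψ hψ => exact .base _ ⟨ψ, hψ, rfl⟩
  | tt => rw [subst_tt hT hF]; exact .tt
  | ff => rw [subst_ff hT hF]; exact .ff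
  | conj φ ψ _ _ h1 h2 => rw [subst_conj hT hF]; exact .conj _ _ h1 h2
  | disj φ ψ _ _ h1 h2 => rw [subst_disj hT hF]; exact .disj _ _ h1 h2

/-- The unsubstituted θ is recorded because the labels later apply a different substitution to the
same θ. -/
theorem exists_af_subst_eq_of_mem_sf {T F : Set (LTL Ap)} (hT : IsGlobSet T) (hF : IsGlobSet F)
    (ν : Set Ap) {φ ψ : LTL Ap} (h : ψ ∈ sf φ) :
    ∃ θ, IsBoolComb (sf φ) θ ∧ af (subst T F ψ) ν = subst T F θ := by
  induction ψ with
  | tt => exact ⟨tt, .tt, by rw [subst_tt hT hF]; rfl⟩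
  | ff => exact ⟨ff, .ff, by rw [subst_ff hT hF]; rfl⟩
  | lit a =>
    rw [subst_lit hT hF, af]
    split_ifs
    exacts [⟨tt, .tt, (subst_tt hT hF).symm⟩, ⟨ff, .ff, (subst_ff hT hF).symm⟩]
  | nlit a =>
    rw [subst_nlit hT hF, af]
    split_ifs
    exacts [⟨ff, .ff, (subst_ff hT hF).symm⟩, ⟨tt, .tt, (subst_tt hT hF).symm⟩]
  | conj ψ₁ ψ₂ h1 h2 =>
    obtain ⟨θ₁, hθ₁, e₁⟩ := h1 (sf_subset_of_mem h (.inr (.inl (mem_sf_self _))))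
    obtain ⟨θ₂, hθ₂, e₂⟩ := h2 (sf_subset_of_mem h (.inr (.inr (mem_sf_self _))))
    exact ⟨_, .conj _ _ hθ₁ hθ₂, by rw [subst_conj hT hF, subst_conj hT hF, af, e₁, e₂]⟩
  | disj ψ₁ ψ₂ h1 h2 =>
    obtain ⟨θ₁, hθ₁, e₁⟩ := h1 (sf_subset_of_mem h (.inr (.inl (mem_sf_self _))))
    obtain ⟨θ₂, hθ₂, e₂⟩ := h2 (sf_subset_of_mem h (.inr (.inr (mem_sf_self _))))
    exact ⟨_, .disj _ _ hθ₁ hθ₂, by rw [subst_disj hT hF, subst_disj hT hF, af, e₁, e₂]⟩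
  | next ψ _ =>
    exact ⟨ψ, .base _ (sf_subset_of_mem h (.inr (mem_sf_self _))), by
      rw [subst_next hT hF, af]⟩
  | ev ψ h1 =>
    obtain ⟨θ₁, hθ₁, e₁⟩ := h1 (sf_subset_of_mem h (.inr (mem_sf_self _)))
    exact ⟨_, .disj _ _ hθ₁ (.base _ h), by
      rw [subst_disj hT hF, subst_ev hT hF, af, e₁]⟩
  | glob ψ h1 =>
    by_cases hmT : glob ψ ∈ T
    · exact ⟨tt, .tt, by rw [subst_glob_of_mem_left hmT, subst_tt hT hF]; rfl⟩
    by_cases hmF : glob ψ ∈ F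
    · exact ⟨ff, .ff, by rw [subst_glob_of_mem_right hmT hmF, subst_ff hT hF]; rfl⟩
    obtain ⟨θ₁, hθ₁, e₁⟩ := h1 (mem_sf_of_glob_mem h)
    exact ⟨_, .conj _ _ hθ₁ (.base _ h), by
      rw [subst_conj hT hF, subst_glob_of_notMem hmT hmF, af, e₁]⟩
  | untl ψ₁ ψ₂ h1 h2 =>
    obtain ⟨θ₁, hθ₁, e₁⟩ := h1 (sf_subset_of_mem h (.inr (.inl (mem_sf_self _))))
    obtain ⟨θ₂, hθ₂, e₂⟩ := h2 (sf_subset_of_mem h (.inr (.inr (mem_sf_self _))))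
    exact ⟨_, .disj _ _ hθ₂ (.conj _ _ hθ₁ (.base _ h)), by
      rw [subst_disj hT hF, subst_conj hT hF, subst_untl hT hF, af, e₁, e₂]⟩

theorem exists_af_subst_eq {T F : Set (LTL Ap)} (hT : IsGlobSet T) (hF : IsGlobSet F)
    (ν : Set Ap) {φ θ : LTL Ap} (h : IsBoolComb (sf φ) θ) :
    ∃ θ', IsBoolComb (sf φ) θ' ∧ af (subst T F θ) ν = subst T F θ' := by
  induction h with
  | base ψ hψ => exact exists_af_subst_eq_of_mem_sf hT hF ν hψ
  | tt => exact ⟨tt, .tt, by rw [subst_tt hT hF]; rfl⟩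
  | ff => exact ⟨ff, .ff, by rw [subst_ff hT hF]; rfl⟩
  | conj ψ₁ ψ₂ _ _ h1 h2 =>
    obtain ⟨θ₁, hθ₁, e₁⟩ := h1
    obtain ⟨θ₂, hθ₂, e₂⟩ := h2
    exact ⟨_, .conj _ _ hθ₁ hθ₂, by rw [subst_conj hT hF, subst_conj hT hF, af, e₁, e₂]⟩
  | disj ψ₁ ψ₂ _ _ h1 h2 =>
    obtain ⟨θ₁, hθ₁, e₁⟩ := h1
    obtain ⟨θ₂, hθ₂, e₂⟩ := h2
    exact ⟨_, .disj _ _ hθ₁ hθ₂, by rw [subst_disj hT hF, subst_disj hT hF, af, e₁, e₂]⟩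

/-- The classes of the formulas `θ[T, F]` for Boolean combinations `θ` of subformulas of `φ`. -/
def combClasses (φ : LTL Ap) (T F : Set (LTL Ap)) : Set (Cls Ap) :=
  {c | ∃ θ, IsBoolComb (sf φ) θ ∧ c = Cls.mk (subst T F θ)}

section

variable {φ : LTL Ap} {T F : Set (LTL Ap)}

theorem tt_mem_combClasses (hT : IsGlobSet T) (hF : IsGlobSet F) :
    Cls.mk tt ∈ combClasses φ T F := ⟨tt, .tt, by rw [subst_tt hT hF]⟩

theorem af_mem_combClasses (hT : IsGlobSet T) (hF : IsGlobSet F) {c : Cls Ap}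
    (hc : c ∈ combClasses φ T F) (ν : Set Ap) : c.af ν ∈ combClasses φ T F := by
  obtain ⟨θ, hθ, rfl⟩ := hc
  obtain ⟨θ', hθ', e⟩ := exists_af_subst_eq hT hF ν hθ
  exact ⟨θ', hθ', by rw [Cls.af_mk, e]⟩

theorem conj_mem_combClasses (hT : IsGlobSet T) (hF : IsGlobSet F) {c d : Cls Ap}
    (hc : c ∈ combClasses φ T F) (hd : d ∈ combClasses φ T F) :
    c.conj d ∈ combClasses φ T F := by
  obtain ⟨θ, hθ, rfl⟩ := hc
  obtain ⟨θ', hθ', rfl⟩ := hd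
  exact ⟨_, .conj _ _ hθ hθ', by rw [Cls.conj_mk, subst_conj hT hF]⟩

theorem reach_subset_combClasses (hT : IsGlobSet T) (hF : IsGlobSet F) {c : Cls Ap}
    (hc : c ∈ combClasses φ T F) : c.reach ⊆ combClasses φ T F := by
  rintro _ ⟨u, rfl⟩
  induction u generalizing c with
  | nil => exact hc
  | cons ν u ih => exact ih (af_mem_combClasses hT hF hc ν)

theorem monReach_subset_combClasses (hT : IsGlobSet T) (hF : IsGlobSet F) {c : Cls Ap}
    (hc : c ∈ combClasses φ T F) : monReach c ⊆ combClasses φ T F ×ˢ combClasses φ T F := by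
  rintro _ ⟨u, rfl⟩
  induction u using List.reverseRecOn with
  | nil => exact ⟨hc, tt_mem_combClasses hT hF⟩
  | append_singleton u ν ih =>
    rw [List.foldl_append, List.foldl_cons, List.foldl_nil, monStep]
    have h1 := af_mem_combClasses hT hF ih.1 ν
    have h2 := conj_mem_combClasses hT hF (af_mem_combClasses hT hF ih.2 ν) hc
    split_ifs
    exacts [⟨h2, tt_mem_combClasses hT hF⟩, ⟨h1, h2⟩]

end

theorem InState.mem_combClasses {φ : LTL Ap} (q : InState φ) : q.1 ∈ combClasses φ ∅ ∅ :=
  reach_subset_combClasses isGlobSet_empty isGlobSet_empty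
    ⟨φ, .base _ (mem_sf_self φ), by rw [subst_empty]⟩ q.2

theorem atG_mem_combClasses {φ : LTL Ap} {c : Cls Ap} (hc : c ∈ combClasses φ ∅ ∅)
    (𝒢 : GSet φ) : Cls.atG 𝒢 c ∈ combClasses φ 𝒢.1 (gsf φ \ 𝒢.1) := by
  obtain ⟨θ, hθ, rfl⟩ := hc
  exact ⟨θ, hθ, by rw [subst_empty]; rfl⟩

theorem AcState.main_mem_combClasses {φ : LTL Ap} (s : AcState φ) :
    s.main ∈ combClasses φ s.G.1 (gsf φ \ s.G.1) := by
  obtain ⟨χ, h⟩ := s.main_mem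
  exact reach_subset_combClasses s.G.isGlobSet s.G.isGlobSet_compl
    (atG_mem_combClasses χ.mem_combClasses s.G) h

theorem GSet.mem_sf {φ : LTL Ap} (𝒢 : GSet φ) (i : {ψ : LTL Ap // glob ψ ∈ 𝒢.1}) :
    i.1 ∈ sf φ := mem_sf_of_glob_mem (𝒢.2 i.2).1

theorem AcState.mon_mem_combClasses {φ : LTL Ap} (s : AcState φ)
    (i : {ψ : LTL Ap // glob ψ ∈ s.G.1}) :
    s.mon i ∈ combClasses φ s.G.1 (gsf φ \ s.G.1) ×ˢ combClasses φ s.G.1 (gsf φ \ s.G.1) :=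
  have h : Cls.mk (atG s.G i.1) ∈ combClasses φ s.G.1 (gsf φ \ s.G.1) :=
    ⟨i.1, .base _ (s.G.mem_sf i), rfl⟩
  monReach_subset_combClasses s.G.isGlobSet s.G.isGlobSet_compl h (s.mon_mem i)

/-! ### Promptness of the components -/

/-- Each G-subformula of φ is in 𝒢 or in its complement, so every G disappears and the closure
properties of promptness suffice. -/
theorem prompt_atG_of_mem_sf {φ ψ : LTL Ap} (𝒢 : GSet φ) (h : ψ ∈ sf φ) :
    (Cls.mk (atG 𝒢 ψ)).Prompt := by
  have hT := 𝒢.isGlobSet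
  have hF := 𝒢.isGlobSet_compl
  unfold atG
  induction ψ with
  | tt => rw [subst_tt hT hF]; exact Cls.prompt_tt
  | ff => rw [subst_ff hT hF]; exact Cls.prompt_ff
  | lit a => rw [subst_lit hT hF]; exact Cls.prompt_lit a
  | nlit a => rw [subst_nlit hT hF]; exact Cls.prompt_nlit a
  | conj ψ₁ ψ₂ h1 h2 =>
    rw [subst_conj hT hF, ← Cls.conj_mk]
    exact (h1 (sf_subset_of_mem h (.inr (.inl (mem_sf_self _))))).conj
      (h2 (sf_subset_of_mem h (.inr (.inr (mem_sf_self _)))))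
  | disj ψ₁ ψ₂ h1 h2 =>
    rw [subst_disj hT hF]
    exact (h1 (sf_subset_of_mem h (.inr (.inl (mem_sf_self _))))).disj
      (h2 (sf_subset_of_mem h (.inr (.inr (mem_sf_self _)))))
  | next ψ h1 =>
    rw [subst_next hT hF]
    exact (h1 (sf_subset_of_mem h (.inr (mem_sf_self _)))).next
  | ev ψ h1 =>
    rw [subst_ev hT hF]
    exact (h1 (sf_subset_of_mem h (.inr (mem_sf_self _)))).ev
  | glob ψ _ =>
    by_cases hm : glob ψ ∈ 𝒢.1
    · rw [subst_glob_of_mem_left hm]; exact Cls.prompt_tt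
    · have hm' : glob ψ ∈ gsf φ \ 𝒢.1 := ⟨⟨h, ψ, rfl⟩, hm⟩
      rw [subst_glob_of_mem_right hm hm']; exact Cls.prompt_ff
  | untl ψ₁ ψ₂ h1 h2 =>
    rw [subst_untl hT hF]
    exact (h1 (sf_subset_of_mem h (.inr (.inl (mem_sf_self _))))).untl
      (h2 (sf_subset_of_mem h (.inr (.inr (mem_sf_self _)))))

theorem prompt_of_mem_combClasses {φ : LTL Ap} (𝒢 : GSet φ) {c : Cls Ap}
    (hc : c ∈ combClasses φ 𝒢.1 (gsf φ \ 𝒢.1)) : c.Prompt := by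
  have hT := 𝒢.isGlobSet
  have hF := 𝒢.isGlobSet_compl
  obtain ⟨θ, hθ, rfl⟩ := hc
  induction hθ with
  | base ψ hψ => exact prompt_atG_of_mem_sf 𝒢 hψ
  | tt => rw [subst_tt hT hF]; exact Cls.prompt_tt
  | ff => rw [subst_ff hT hF]; exact Cls.prompt_ff
  | conj ψ₁ ψ₂ _ _ h1 h2 => rw [subst_conj hT hF, ← Cls.conj_mk]; exact h1.conj h2
  | disj ψ₁ ψ₂ _ _ h1 h2 => rw [subst_disj hT hF]; exact h1.disj h2

/-! ### Finiteness -/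

theorem IsBoolComb.exists_propEval_iff {S : Set (LTL Ap)} {θ : LTL Ap} (h : IsBoolComb S θ) :
    ∃ g : (S → Prop) → Prop, ∀ v, propEval v θ ↔ g fun s => propEval v s.1 := by
  induction h with
  | base ψ hψ => exact ⟨fun p => p ⟨ψ, hψ⟩, fun v => Iff.rfl⟩
  | tt => exact ⟨fun _ => True, fun v => Iff.rfl⟩
  | ff => exact ⟨fun _ => False, fun v => Iff.rfl⟩
  | conj ψ₁ ψ₂ _ _ h1 h2 =>
    obtain ⟨g₁, h1⟩ := h1
    obtain ⟨g₂, h2⟩ := h2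
    exact ⟨fun p => g₁ p ∧ g₂ p, fun v => and_congr (h1 v) (h2 v)⟩
  | disj ψ₁ ψ₂ _ _ h1 h2 =>
    obtain ⟨g₁, h1⟩ := h1
    obtain ⟨g₂, h2⟩ := h2
    exact ⟨fun p => g₁ p ∨ g₂ p, fun v => or_congr (h1 v) (h2 v)⟩

theorem finite_setOf_isBoolComb {S : Set (LTL Ap)} (hS : S.Finite) :
    {c | ∃ θ, IsBoolComb S θ ∧ c = Cls.mk θ}.Finite := by
  have := hS.to_subtype
  have : Nonempty (Cls Ap) := ⟨Cls.mk tt⟩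
  let P : ((S → Prop) → Prop) → Cls Ap → Prop := fun g c =>
    ∃ θ, c = Cls.mk θ ∧ ∀ v, propEval v θ ↔ g fun s => propEval v s.1
  -- A class is determined by its truth function g of the members of S, and there are finitely many
  -- g; a g that no class realises gets an arbitrary value.
  refine (Set.finite_range fun g => Classical.epsilon (P g)).subset ?_
  rintro _ ⟨θ, hθ, rfl⟩
  obtain ⟨g, hg⟩ := hθ.exists_propEval_iff
  obtain ⟨θ', he, hg'⟩ := Classical.epsilon_spec (p := P g) ⟨_, θ, rfl, hg⟩
  exact ⟨g, he.trans (Cls.mk_eq_mk.2 fun v => (hg' v).trans (hg v).symm)⟩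

theorem finite_combClasses {T F : Set (LTL Ap)} (hT : IsGlobSet T) (hF : IsGlobSet F)
    (φ : LTL Ap) : (combClasses φ T F).Finite := by
  refine (finite_setOf_isBoolComb ((finite_sf φ).image (subst T F))).subset ?_
  rintro _ ⟨θ, hθ, rfl⟩
  refine ⟨_, ?_, rfl⟩
  convert hθ.subst hT hF using 1
  ext χ
  simp [eq_comm]

instance (φ : LTL Ap) : Finite (InState φ) :=
  ((finite_combClasses isGlobSet_empty isGlobSet_empty φ).subset
    fun q hq => InState.mem_combClasses ⟨q, hq⟩).to_subtype

instance (φ : LTL Ap) : Finite (GSet φ) := (finite_gsf φ).finite_subsets.to_subtype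

instance {φ : LTL Ap} (𝒢 : GSet φ) : Finite {ψ : LTL Ap // glob ψ ∈ 𝒢.1} :=
  ((finite_sf φ).subset (t := {ψ | glob ψ ∈ 𝒢.1}) fun ψ h => 𝒢.mem_sf ⟨ψ, h⟩).to_subtype

instance (φ : LTL Ap) : Finite (AcState φ) := by
  let C (𝒢 : GSet φ) : Set (Cls Ap) := combClasses φ 𝒢.1 (gsf φ \ 𝒢.1)
  have hC : ∀ 𝒢, Finite (C 𝒢) := fun 𝒢 =>
    (finite_combClasses 𝒢.isGlobSet 𝒢.isGlobSet_compl φ).to_subtype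
  let f : AcState φ → Σ 𝒢 : GSet φ, C 𝒢 × ({ψ : LTL Ap // glob ψ ∈ 𝒢.1} → C 𝒢 × C 𝒢) :=
    fun s => ⟨s.G, ⟨s.main, s.main_mem_combClasses⟩, fun i =>
      (⟨(s.mon i).1, (s.mon_mem_combClasses i).1⟩, ⟨(s.mon i).2, (s.mon_mem_combClasses i).2⟩)⟩
  refine Finite.of_injective f ?_
  rintro ⟨G, m, p, hm, hp⟩ ⟨G', m', p', hm', hp'⟩ h
  obtain ⟨rfl, h⟩ := Sigma.mk.inj h
  have h := Prod.mk.inj (eq_of_heq h)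
  obtain rfl : m = m' := congrArg Subtype.val h.1
  obtain rfl : p = p' := funext fun i => Prod.ext
    (congrArg (fun x => x.1.1) (congrFun h.2 i)) (congrArg (fun x => x.2.1) (congrFun h.2 i))
  rfl

end LTL

/-! ### Removing and prepending the first transition of a run -/

namespace BuchiAut

variable {Al : Type*} {A : BuchiAut Al}

theorem isRun_tail_of_label_zero_eq_some {s : A.State} {w : ℕ → Al} {ρ : ℕ → A.State}
    {l : ℕ → Option Al} (h : A.IsRun s w ρ l) {a : Al} (ha : l 0 = some a) :
    a = w 0 ∧ A.IsRun (ρ 1) (fun n => w (n + 1)) (fun n => ρ (n + 1)) (fun n => l (n + 1)) := by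
  obtain ⟨-, htr, f, hf, hfw, hfe⟩ := h
  have h0 : f 0 = 0 := by
    by_contra h0
    have : l 0 = none := hfe 0 (by
      rintro ⟨k, hk⟩
      have := hf.monotone (Nat.zero_le k)
      omega)
    rw [ha] at this
    cases this
  -- The tail drops the letter at position f 0 = 0 and shifts the others by one; since f (k + 1) >
  -- 0, the truncated subtraction is exact.
  have hpos : ∀ k, f (k + 1) - 1 + 1 = f (k + 1) := fun k => by
    have := hf (Nat.succ_pos k)
    simp only [Nat.succ_eq_add_one] at this
    omega
  refine ⟨?_, rfl, fun n => htr (n + 1), fun k => f (k + 1) - 1, ?_, ?_, ?_⟩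
  · have := hfw 0
    rw [h0, ha] at this
    exact Option.some.inj this
  · intro j k hjk
    have := hf (Nat.succ_lt_succ hjk)
    simp only [Nat.succ_eq_add_one] at this
    have := hpos j
    have := hpos k
    show f (j + 1) - 1 < f (k + 1) - 1
    omega
  · intro k
    simp only [hpos]
    exact hfw (k + 1)
  · intro n hn
    refine hfe (n + 1) ?_
    rintro ⟨_ | k, hk⟩
    · omega
    · exact hn ⟨k, by simp only; omega⟩

theorem isRun_tail_of_label_zero_eq_none {s : A.State} {w : ℕ → Al} {ρ : ℕ → A.State}
    {l : ℕ → Option Al} (h : A.IsRun s w ρ l) (ha : l 0 = none) :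
    A.IsRun (ρ 1) w (fun n => ρ (n + 1)) (fun n => l (n + 1)) := by
  obtain ⟨-, htr, f, hf, hfw, hfe⟩ := h
  have hpos : ∀ k, f k - 1 + 1 = f k := fun k => by
    have : f k ≠ 0 := fun h0 => by
      have := hfw k
      rw [h0, ha] at this
      cases this
    omega
  refine ⟨rfl, fun n => htr (n + 1), fun k => f k - 1, ?_, ?_, ?_⟩
  · intro j k hjk
    have := hf hjk
    have := hpos j
    have := hpos k
    show f j - 1 < f k - 1
    omega
  · intro k
    simp only [hpos]
    exact hfw k
  · intro n hn
    refine hfe (n + 1) ?_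
    rintro ⟨k, hk⟩
    exact hn ⟨k, by simp only; omega⟩

theorem isRun_cons_some {s s' : A.State} {w : ℕ → Al} {ρ : ℕ → A.State} {l : ℕ → Option Al}
    (htr : A.tr s (some (w 0)) s') (h : A.IsRun s' (fun n => w (n + 1)) ρ l) :
    A.IsRun s w (fun n => Nat.casesOn n s ρ) (fun n => Nat.casesOn n (some (w 0)) l) := by
  obtain ⟨rfl, htr', f, hf, hfw, hfe⟩ := h
  refine ⟨rfl, ?_, fun k => Nat.casesOn k 0 fun k => f k + 1, ?_, ?_, ?_⟩
  · rintro (_ | n)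
    exacts [htr, htr' n]
  · refine strictMono_nat_of_lt_succ ?_
    rintro (_ | k)
    · exact Nat.succ_pos _
    · exact Nat.succ_lt_succ (hf k.lt_succ_self)
  · rintro (_ | k)
    exacts [rfl, hfw k]
  · rintro (_ | n) hn
    · exact (hn ⟨0, rfl⟩).elim
    · refine hfe n ?_
      rintro ⟨k, rfl⟩
      exact hn ⟨k + 1, rfl⟩

theorem isRun_cons_none {s s' : A.State} {w : ℕ → Al} {ρ : ℕ → A.State} {l : ℕ → Option Al}
    (htr : A.tr s none s') (h : A.IsRun s' w ρ l) :
    A.IsRun s w (fun n => Nat.casesOn n s ρ) (fun n => Nat.casesOn n none l) := by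
  obtain ⟨rfl, htr', f, hf, hfw, hfe⟩ := h
  refine ⟨rfl, ?_, fun k => f k + 1, fun j k hjk => Nat.succ_lt_succ (hf hjk), hfw, ?_⟩
  · rintro (_ | n)
    exacts [htr, htr' n]
  · rintro (_ | n) hn
    · rfl
    · refine hfe n ?_
      rintro ⟨k, rfl⟩
      exact hn ⟨k, rfl⟩

theorem mem_langFrom_of_some {s s' : A.State} {w : ℕ → Al} (htr : A.tr s (some (w 0)) s')
    (h : (fun n => w (n + 1)) ∈ A.langFrom s') : w ∈ A.langFrom s := by
  obtain ⟨ρ, l, hrun, hacc⟩ := h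
  refine ⟨_, _, isRun_cons_some htr hrun, fun i N => ?_⟩
  obtain ⟨n, hn, h⟩ := hacc i N
  exact ⟨n + 1, by omega, h⟩

theorem mem_langFrom_of_none {s s' : A.State} {w : ℕ → Al} (htr : A.tr s none s')
    (h : w ∈ A.langFrom s') : w ∈ A.langFrom s := by
  obtain ⟨ρ, l, hrun, hacc⟩ := h
  refine ⟨_, _, isRun_cons_none htr hrun, fun i N => ?_⟩
  obtain ⟨n, hn, h⟩ := hacc i N
  exact ⟨n + 1, by omega, h⟩

end BuchiAut

namespace LTL

variable {Ap : Type*} {φ : LTL Ap}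

/-! ### The accepting component -/

/-- The state of the accepting component reached from `s` after `n` letters of `w`. -/
noncomputable def acRun (s : AcState φ) (w : ℕ → Set Ap) : ℕ → AcState φ
  | 0 => s
  | n + 1 => acStep (acRun s w n) (w n)

theorem acRun_G (s : AcState φ) (w : ℕ → Set Ap) (n : ℕ) : (acRun s w n).G = s.G := by
  induction n with
  | zero => rfl
  | succ n ih => exact ih

theorem acRun_main (s : AcState φ) (w : ℕ → Set Ap) (n : ℕ) :
    (acRun s w n).main = s.main.afWord w n := by
  induction n with
  | zero => rfl
  | succ n ih => rw [Cls.afWord_succ, ← ih]; rfl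

/-- The index type of `mon` depends on the state, hence the two membership proofs. -/
theorem acRun_mon (s : AcState φ) (w : ℕ → Set Ap) (n : ℕ) {ψ : LTL Ap}
    (h : glob ψ ∈ (acRun s w n).G.1) (h' : glob ψ ∈ s.G.1) :
    (acRun s w n).mon ⟨ψ, h⟩ = monRun (Cls.mk (atG s.G ψ)) (s.mon ⟨ψ, h'⟩) w n := by
  induction n with
  | zero => rfl
  | succ n ih =>
    have h'' : glob ψ ∈ (acRun s w n).G.1 := by rwa [acRun_G]
    rw [monRun, ← ih h'', ← acRun_G s w n]
    rfl

theorem isRun_acRun (s : AcState φ) (w : ℕ → Set Ap) :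
    (ldba φ).IsRun (.inr s) w (fun n => .inr (acRun s w n)) (fun n => some (w n)) :=
  ⟨rfl, fun _ => .acStep _ _, id, strictMono_id, fun _ => rfl, fun n hn => (hn ⟨n, rfl⟩).elim⟩

theorem eq_acRun_of_isRun {s : AcState φ} {w : ℕ → Set Ap} {ρ : ℕ → (ldba φ).State}
    {l : ℕ → Option (Set Ap)} (h : (ldba φ).IsRun (.inr s) w ρ l) (n : ℕ) :
    ρ n = .inr (acRun s w n) ∧ l n = some (w n) := by
  obtain ⟨h0, htr, f, hf, hfw, hfe⟩ := h
  have step : ∀ (t : AcState φ) a q, (ldba φ).tr (.inr t) a q →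
      ∃ ν, a = some ν ∧ q = .inr (acStep t ν) := by
    rintro t a q (_ | ⟨_, ν⟩ | _)
    exact ⟨ν, rfl, rfl⟩
  have hinr : ∀ n, ∃ t, ρ n = .inr t := by
    intro n
    induction n with
    | zero => exact ⟨s, h0⟩
    | succ n ih =>
      obtain ⟨t, ht⟩ := ih
      obtain ⟨ν, -, h⟩ := step t _ _ (ht ▸ htr n)
      exact ⟨_, h⟩
  -- No ε-transition leaves the accepting component, so every position carries a letter and the
  -- strictly increasing f is the identity.
  have hsurj : Function.Surjective f := by
    intro n
    by_contra hn
    obtain ⟨t, ht⟩ := hinr n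
    obtain ⟨ν, h, -⟩ := step t _ _ (ht ▸ htr n)
    rw [hfe n hn] at h
    cases h
  have hid : f = id := (hf.range_inj strictMono_id).1 (by rw [hsurj.range_eq, Set.range_id])
  have hl : ∀ n, l n = some (w n) := fun n => by simpa [hid] using hfw n
  refine ⟨?_, hl n⟩
  induction n with
  | zero => exact h0
  | succ n ih =>
    obtain ⟨ν, h, h'⟩ := step _ _ _ (ih ▸ htr n)
    rw [hl n] at h
    obtain rfl := Option.some.inj h
    exact h'

theorem mem_acc_iff {i : (ldba φ).Idx} {s : AcState φ} {ν : Set Ap} :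
    ((.inr s, some ν, .inr (acStep s ν)) :
        (ldba φ).State × Option (Set Ap) × (ldba φ).State) ∈ (ldba φ).acc i ↔
      s.main = Cls.mk tt ∧ ∀ (j : {ψ : LTL Ap // glob ψ ∈ gsf φ}) (h : glob j.1 ∈ s.G.1),
        i = some j → monAcc (s.mon ⟨j.1, h⟩) ν := by
  constructor
  · rintro ⟨s', ν', he, h⟩
    obtain ⟨h1, h2⟩ := Prod.mk.inj he
    obtain rfl := Sum.inr.inj h1
    obtain rfl := Option.some.inj (Prod.mk.inj h2).1
    exact h
  · exact fun h => ⟨s, ν, rfl, h⟩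

theorem mem_langFrom_inr_iff_acRun {s : AcState φ} {w : ℕ → Set Ap} :
    w ∈ (ldba φ).langFrom (.inr s) ↔ ∀ i : (ldba φ).Idx, ∀ N, ∃ n ≥ N,
      (acRun s w n).main = Cls.mk tt ∧
        ∀ (j : {ψ : LTL Ap // glob ψ ∈ gsf φ}) (h : glob j.1 ∈ (acRun s w n).G.1),
          i = some j → monAcc ((acRun s w n).mon ⟨j.1, h⟩) (w n) := by
  constructor
  · rintro ⟨ρ, l, hrun, hacc⟩ i N
    obtain ⟨n, hn, h⟩ := hacc i N
    rw [(eq_acRun_of_isRun hrun n).1, (eq_acRun_of_isRun hrun n).2,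
      (eq_acRun_of_isRun hrun (n + 1)).1] at h
    exact ⟨n, hn, mem_acc_iff.1 h⟩
  · intro h
    refine ⟨_, _, isRun_acRun s w, fun i N => ?_⟩
    obtain ⟨n, hn, h⟩ := h i N
    exact ⟨n, hn, mem_acc_iff.2 h⟩

/-- By promptness the first component becomes tt iff it is satisfied, and then it stays tt; what
remains of the acceptance condition is that of each monitor separately. -/
theorem mem_langFrom_inr_iff {s : AcState φ} {w : ℕ → Set Ap} :
    w ∈ (ldba φ).langFrom (.inr s) ↔ s.main.Sat w ∧
      ∀ i : {ψ : LTL Ap // glob ψ ∈ s.G.1}, (s.mon i).1.Sat w ∧ (s.mon i).2.Sat w ∧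
        ∀ k, Sat (atG s.G i.1) (suffix w k) := by
  have hmon : ∀ i : {ψ : LTL Ap // glob ψ ∈ s.G.1},
      (∀ N, ∃ n ≥ N, monAcc (monRun (Cls.mk (atG s.G i.1)) (s.mon i) w n) (w n)) ↔
        (s.mon i).1.Sat w ∧ (s.mon i).2.Sat w ∧ ∀ k, Sat (atG s.G i.1) (suffix w k) :=
    fun i => infinitely_many_monAcc_iff (prompt_atG_of_mem_sf s.G (s.G.mem_sf i)) (s.mon_mem i) w
  simp only [← hmon]
  rw [mem_langFrom_inr_iff_acRun]
  constructor
  · intro h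
    constructor
    · obtain ⟨n, -, hn, -⟩ := h none 0
      rw [acRun_main] at hn
      exact Cls.sat_of_afWord_eq_tt hn
    · intro i N
      obtain ⟨n, hn, -, hacc⟩ := h (some ⟨i.1, s.G.2 i.2⟩) N
      have h' : glob i.1 ∈ (acRun s w n).G.1 := by rw [acRun_G]; exact i.2
      have := hacc ⟨i.1, s.G.2 i.2⟩ h' rfl
      rw [acRun_mon s w n h' i.2] at this
      exact ⟨n, hn, this⟩
  · rintro ⟨hmain, h⟩ i N
    obtain ⟨m, hm⟩ := prompt_of_mem_combClasses s.G s.main_mem_combClasses w hmain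
    -- The index `none` and the G-subformulas outside 𝒢 only ask for the first component tt.
    by_cases hi : ∃ j : {ψ : LTL Ap // glob ψ ∈ s.G.1}, i = some ⟨j.1, s.G.2 j.2⟩
    · obtain ⟨j, rfl⟩ := hi
      obtain ⟨n, hn, hacc⟩ := h j (max m N)
      refine ⟨n, (le_max_right m N).trans hn, ?_, ?_⟩
      · rw [acRun_main]
        exact Cls.afWord_eq_tt_mono ((le_max_left m N).trans hn) hm
      · rintro j' h' he
        obtain rfl := Option.some.inj he
        rw [acRun_mon s w n h' j.2]
        exact hacc
    · refine ⟨max m N, le_max_right m N, ?_, ?_⟩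
      · rw [acRun_main]
        exact Cls.afWord_eq_tt_mono (le_max_left m N) hm
      · rintro j h' rfl
        rw [acRun_G] at h'
        exact (hi ⟨⟨j.1, h'⟩, rfl⟩).elim

theorem exists_isBoolComb_sat_iff_forall {S : Set (LTL Ap)} {ι : Type*} [Finite ι]
    (f : ι → LTL Ap) (hf : ∀ i, IsBoolComb S (f i)) :
    ∃ θ, IsBoolComb S θ ∧ ∀ w, Sat θ w ↔ ∀ i, Sat (f i) w := by
  classical
  have key : ∀ s : Finset ι, ∃ θ, IsBoolComb S θ ∧ ∀ w, Sat θ w ↔ ∀ i ∈ s, Sat (f i) w := by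
    intro s
    induction s using Finset.induction_on with
    | empty => exact ⟨tt, .tt, by simp [Sat]⟩
    | insert i s _ ih =>
      obtain ⟨θ, hθ, h⟩ := ih
      exact ⟨_, .conj _ _ (hf i) hθ, fun w => by simp [Sat, h]⟩
  have := Fintype.ofFinite ι
  simpa using key Finset.univ

theorem exists_label_inr (s : AcState φ) :
    ∃ θ, (ldba φ).langFrom (.inr s) = lang θ ∧
      IsBoolComb {χ | ∃ ψ ∈ φ.sf, χ = subst ∅ (gsf φ \ s.G.1) ψ} θ := by
  have hT := s.G.isGlobSet
  have hF := s.G.isGlobSet_compl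
  obtain ⟨θ, hθ, eθ⟩ := s.main_mem_combClasses
  choose θ₁ hθ₁ e₁ using fun i => (s.mon_mem_combClasses i).1
  choose θ₂ hθ₂ e₂ using fun i => (s.mon_mem_combClasses i).2
  -- For Gψ in 𝒢, the formula G(ψ[∅, F]) equals (Gψ)[∅, F], because Gψ is not in F. This makes the
  -- last conjunct admissible.
  obtain ⟨μ, hμ, eμ⟩ := exists_isBoolComb_sat_iff_forall
    (S := {χ | ∃ ψ ∈ φ.sf, χ = subst ∅ (gsf φ \ s.G.1) ψ})
    (fun i : {ψ : LTL Ap // glob ψ ∈ s.G.1} =>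
      conj (subst ∅ (gsf φ \ s.G.1) (θ₁ i)) (conj (subst ∅ (gsf φ \ s.G.1) (θ₂ i))
        (glob (subst ∅ (gsf φ \ s.G.1) i.1))))
    (fun i => .conj _ _ ((hθ₁ i).subst isGlobSet_empty hF)
      (.conj _ _ ((hθ₂ i).subst isGlobSet_empty hF) (.base _ ⟨glob i.1, (s.G.2 i.2).1,
        (subst_glob_of_notMem (Set.notMem_empty _) fun h => h.2 i.2).symm⟩)))
  refine ⟨conj (subst ∅ (gsf φ \ s.G.1) θ) μ, ?_,
    .conj _ _ (hθ.subst isGlobSet_empty hF) hμ⟩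
  ext w
  rw [mem_langFrom_inr_iff]
  simp only [lang, Set.mem_ofPred_eq, sat_conj, eμ, sat_glob, eθ, e₁, e₂, Cls.sat_mk]
  constructor
  · rintro ⟨h, hi⟩
    have key := sat_subst_empty_left (w := w) hT Set.disjoint_sdiff_right
      fun ψ hψ => (hi ⟨ψ, hψ⟩).2.2
    exact ⟨(key _ 0).2 h, fun i => ⟨(key _ 0).2 (hi i).1, (key _ 0).2 (hi i).2.1,
      fun k => (key _ k).2 ((hi i).2.2 k)⟩⟩
  · have key := sat_subst_mono (Set.empty_subset s.G.1) (subset_refl (gsf φ \ s.G.1))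
    rintro ⟨h, hi⟩
    exact ⟨key _ _ h, fun i => ⟨key _ _ (hi i).1, key _ _ (hi i).2.1,
      fun k => key _ _ ((hi i).2.2 k)⟩⟩

/-! ### The initial component -/

/-- The monitors justify undoing the replacements by tt; undoing those by ff only weakens the
formula. -/
theorem sat_of_mem_langFrom_jump {q : InState φ} {𝒢 : GSet φ} {w : ℕ → Set Ap}
    (h : w ∈ (ldba φ).langFrom (.inr (jump q 𝒢))) : q.1.Sat w := by
  obtain ⟨h, hi⟩ := mem_langFrom_inr_iff.1 h
  obtain ⟨θ, hq⟩ := q.1.mk_surjective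
  rw [hq]
  replace h : Sat (subst 𝒢.1 (gsf φ \ 𝒢.1) θ) w := by
    simpa only [jump, hq, Cls.atG_mk, Cls.sat_mk, atG] using h
  have h' := (sat_subst_empty_left 𝒢.isGlobSet Set.disjoint_sdiff_right
    (fun ψ hψ => (hi ⟨ψ, hψ⟩).2.2) θ 0).2 h
  have := sat_subst_mono (subset_refl ∅) (Set.empty_subset (gsf φ \ 𝒢.1)) _ _ h'
  rwa [subst_empty] at this

/-- Once true, a G-formula stays true, and φ has finitely many G-subformulas. So from some n on
those in 𝒢 hold at every suffix, while the others hold at none. -/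
theorem exists_forall_ge_sat_iff_sat_atG (φ : LTL Ap) (w : ℕ → Set Ap) :
    ∃ (𝒢 : GSet φ) (n : ℕ), (∀ χ ∈ 𝒢.1, Sat χ (suffix w n)) ∧
      ∀ ψ k, Sat (atG 𝒢 ψ) (suffix (suffix w n) k) ↔ Sat ψ (suffix (suffix w n) k) := by
  let 𝒢 : GSet φ := ⟨{χ | χ ∈ gsf φ ∧ ∃ k, Sat χ (suffix w k)}, fun _ h => h.1⟩
  have hmono : ∀ χ ∈ gsf φ, ∀ k m, k ≤ m → Sat χ (suffix w k) → Sat χ (suffix w m) := by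
    rintro χ ⟨-, ψ, rfl⟩ k m hkm h j
    obtain ⟨d, rfl⟩ := Nat.exists_eq_add_of_le hkm
    have := (sat_suffix_glob.1 h) (j + d)
    rwa [add_assoc, add_comm d k, ← suffix_suffix] at this
  have hev : ∀ᶠ n in Filter.atTop, ∀ χ ∈ 𝒢.1, Sat χ (suffix w n) := by
    rw [Set.Finite.eventually_all ((finite_gsf φ).subset 𝒢.2)]
    rintro χ ⟨hχ, k, hk⟩
    exact Filter.eventually_atTop.2 ⟨k, fun m hm => hmono χ hχ k m hm hk⟩
  obtain ⟨n, hn⟩ := hev.exists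
  refine ⟨𝒢, n, hn, fun ψ k => sat_subst_iff ?_ ?_ ψ k⟩
  · intro χ hχ k
    rw [suffix_suffix]
    exact hmono χ hχ.1 n _ (Nat.le_add_left n k) (hn χ hχ)
  · intro χ hχ k h
    rw [suffix_suffix] at h
    exact hχ.2 ⟨hχ.1, _, h⟩

theorem mem_langFrom_jump {q : InState φ} {𝒢 : GSet φ} {w : ℕ → Set Ap} (hq : q.1.Sat w)
    (hG : ∀ χ ∈ 𝒢.1, Sat χ w)
    (h : ∀ ψ k, Sat (atG 𝒢 ψ) (suffix w k) ↔ Sat ψ (suffix w k)) :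
    w ∈ (ldba φ).langFrom (.inr (jump q 𝒢)) := by
  rw [mem_langFrom_inr_iff]
  refine ⟨?_, fun i => ?_⟩
  · obtain ⟨θ, hθ⟩ := q.1.mk_surjective
    rw [hθ] at hq
    simpa only [jump, hθ, Cls.atG_mk, Cls.sat_mk, suffix_zero] using (h θ 0).2 hq
  · have : ∀ k, Sat (atG 𝒢 i.1) (suffix w k) := fun k => (h _ _).2 (hG _ i.2 k)
    exact ⟨this 0, trivial, this⟩

theorem mem_langFrom_inl_of_mem_langFrom {q q' : InState φ} {w : ℕ → Set Ap} {n : ℕ}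
    (hq : q'.1 = q.1.afWord w n) (h : suffix w n ∈ (ldba φ).langFrom (.inl q')) :
    w ∈ (ldba φ).langFrom (.inl q) := by
  induction n generalizing q w with
  | zero =>
    obtain rfl : q' = q := Subtype.ext hq
    exact h
  | succ n ih =>
    refine BuchiAut.mem_langFrom_of_some (.inStep q (w 0)) (ih (w := suffix w 1) ?_ ?_)
    · rw [hq, Cls.afWord_succ']; rfl
    · rwa [suffix_suffix]

/-- Satisfaction is carried back from the jump to the start of the run, letter by letter; the
induction is on a position already inside the accepting component. -/
theorem sat_of_isRun_inl {q : InState φ} {w : ℕ → Set Ap} {ρ : ℕ → (ldba φ).State}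
    {l : ℕ → Option (Set Ap)} (h : (ldba φ).IsRun (.inl q) w ρ l)
    (hacc : ∀ i : (ldba φ).Idx, ∀ N, ∃ n ≥ N, (ρ n, l n, ρ (n + 1)) ∈ (ldba φ).acc i) {n : ℕ}
    {s : AcState φ} (hn : ρ n = .inr s) : q.1.Sat w := by
  have hacc' : ∀ i : (ldba φ).Idx, ∀ N, ∃ n ≥ N,
      (ρ (n + 1), l (n + 1), ρ (n + 1 + 1)) ∈ (ldba φ).acc i := by
    intro i N
    obtain ⟨n, hn, h⟩ := hacc i (N + 1)
    obtain ⟨m, rfl⟩ := Nat.exists_eq_add_of_le hn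
    exact ⟨N + m, by omega, by rwa [add_right_comm] at h⟩
  induction n generalizing q w ρ l with
  | zero =>
    rw [h.1] at hn
    cases hn
  | succ n ih =>
    have htr := h.2.1 0
    rw [h.1] at htr
    generalize hl : l 0 = a at htr
    generalize hρ : ρ (0 + 1) = r at htr
    cases htr with
    | inStep _ ν =>
      obtain ⟨rfl, hrun⟩ := BuchiAut.isRun_tail_of_label_zero_eq_some h hl
      rw [zero_add] at hρ
      rw [hρ] at hrun
      refine (Cls.sat_af _ _).1 (ih hrun hacc' hn ?_)
      intro i N
      obtain ⟨n, hn, h⟩ := hacc' i (N + 1)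
      obtain ⟨m, rfl⟩ := Nat.exists_eq_add_of_le hn
      exact ⟨N + m, by omega, by rwa [add_right_comm N 1 m] at h⟩
    | jump _ 𝒢 =>
      have hrun := BuchiAut.isRun_tail_of_label_zero_eq_none h hl
      rw [zero_add] at hρ
      rw [hρ] at hrun
      exact sat_of_mem_langFrom_jump ⟨_, _, hrun, hacc'⟩

theorem langFrom_inl (q : InState φ) : (ldba φ).langFrom (.inl q) = {w | q.1.Sat w} := by
  ext w
  constructor
  · rintro ⟨ρ, l, hrun, hacc⟩
    -- Any accepting transition leaves a state of the accepting component, so the run must have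
    -- jumped.
    obtain ⟨n, -, s, ν, h, -⟩ := hacc none 0
    exact sat_of_isRun_inl hrun hacc (Prod.mk.inj h).1
  · intro h
    obtain ⟨𝒢, n, hG, hiff⟩ := exists_forall_ge_sat_iff_sat_atG φ w
    obtain ⟨u, hu⟩ : ∃ u : List (Set Ap), q.1.afWord w n = u.foldl Cls.af q.1 := by
      clear hiff hG
      induction n with
      | zero => exact ⟨[], rfl⟩
      | succ n ih =>
        obtain ⟨u, hu⟩ := ih
        exact ⟨u ++ [w n], by rw [Cls.afWord_succ, hu]; simp⟩
    obtain ⟨u₀, hu₀⟩ := q.2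
    -- The run reads n letters in the initial component, until the G-subformulas have stabilised,
    -- and jumps from here.
    let q' : InState φ := ⟨q.1.afWord w n, u₀ ++ u, by rw [hu, List.foldl_append, ← hu₀]⟩
    refine mem_langFrom_inl_of_mem_langFrom (q' := q') rfl
      (BuchiAut.mem_langFrom_of_none (.jump q' 𝒢) (mem_langFrom_jump ?_ hG hiff))
    exact (Cls.sat_afWord _ _ _).2 h

theorem exists_label_inl (q : InState φ) :
    ∃ θ, (ldba φ).langFrom (.inl q) = lang θ ∧
      IsBoolComb {χ | ∃ ψ ∈ φ.sf, χ = subst ∅ ∅ ψ} θ := by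
  obtain ⟨θ, hθ, e⟩ := q.mem_combClasses
  refine ⟨_, ?_, hθ.subst isGlobSet_empty isGlobSet_empty⟩
  rw [langFrom_inl, e]
  rfl

/-! ### Limit determinism -/

theorem isLimitDet_ldba (φ : LTL Ap) : (ldba φ).IsLimitDet (acPart φ) where
  finite := inferInstanceAs (Finite (InState φ ⊕ AcState φ))
  start_notMem := by rintro ⟨s, h⟩; cases h
  acc_sub := by
    rintro i t ⟨s, ν, rfl, -⟩
    exact ⟨⟨s, rfl⟩, ⟨_, rfl⟩, .acStep s ν⟩
  det := by
    rintro _ ⟨s, rfl⟩ a _ _ (_ | _ | _) (_ | _ | _)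
    rfl
  no_eps := by
    rintro _ ⟨s, rfl⟩ q' h
    cases h
  trap := by
    rintro _ ⟨s, rfl⟩ a _ (_ | _ | _)
    exact ⟨_, rfl⟩

theorem isInitialDet_ldba (φ : LTL Ap) : (ldba φ).IsInitialDet (acPart φ) where
  det := by
    rintro (q | s) hq a
    · refine ⟨.inl (inStep q a), ⟨?_, .inStep q a⟩, ?_⟩
      · rintro ⟨s, h⟩
        cases h
      · rintro _ ⟨-, (_ | _ | _)⟩
        rfl
    · exact (hq ⟨s, rfl⟩).elim
  no_eps := by
    rintro (q | s) hq q' hq' h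
    · cases h with
      | jump _ 𝒢 => exact hq' ⟨_, rfl⟩
    · exact hq ⟨s, rfl⟩

end LTL

theorem mainTheorem7 {Ap : Type*} [Finite Ap] (φ : LTL Ap) :
    (∃ label : (LTL.ldba φ).State → LTL Ap, ∀ s : (LTL.ldba φ).State,
      (LTL.ldba φ).langFrom s = (label s).lang ∧
      ∃ T F : Set (LTL Ap), Disjoint T F ∧
        LTL.IsBoolComb {χ | ∃ ψ ∈ φ.sf, χ = LTL.subst T F ψ} (label s)) ∧
    (LTL.ldba φ).IsLimitDet (LTL.acPart φ) ∧
    (LTL.ldba φ).IsInitialDet (LTL.acPart φ) := by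
  refine ⟨?_, LTL.isLimitDet_ldba φ, LTL.isInitialDet_ldba φ⟩
  have h : ∀ s : (LTL.ldba φ).State, ∃ θ : LTL Ap, (LTL.ldba φ).langFrom s = θ.lang ∧
      ∃ T F : Set (LTL Ap), Disjoint T F ∧
        LTL.IsBoolComb {χ | ∃ ψ ∈ φ.sf, χ = LTL.subst T F ψ} θ := by
    rintro (q | s)
    · obtain ⟨θ, h, hθ⟩ := LTL.exists_label_inl q
      exact ⟨θ, h, ∅, ∅, Set.empty_disjoint _, hθ⟩
    · obtain ⟨θ, h, hθ⟩ := LTL.exists_label_inr s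
      exact ⟨θ, h, ∅, _, Set.empty_disjoint _, hθ⟩
  choose label hlabel using h
  exact ⟨label, hlabel⟩
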